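/- Let $\Phi$ be an irreducible reduced crystallographic root system spanning a Euclidean space $V$, with simple roots $\alpha_1,\dots,\alpha_n$, highest root $\xi$, simple coroots $\alpha_i^\vee$, coroot lattice $Q^\vee=\bigoplus_i\mathbb{Z}\alpha_i^\vee$, fundamental coweights $\omega_i^\vee$ (so $\langle\alpha_i,\omega_j^\vee\rangle=\delta_{ij}$) and finite Weyl group $W$. Let $\widetilde W$ be the affine Weyl group, generated by the reflections of $V$ in the hyperplanes $\{x:\langle x,\alpha\rangle=k\}$ ($\alpha\in\Phi$, $k\in\mathbb{Z}$). Its simple reflections are the reflections $s_1,\dots,s_n$ in $\{x:\langle x,\alpha_i\rangle=0\}$ and the reflection $s_0$ in $\{x:\langle x,\xi\rangle=1\}$. A Coxeter element of $\widetilde W$ is a product of $s_0,\dots,s_n$, each taken once, in some order. For $\lambda\in Q^\vee$ let $t_\lambda\in\widetilde W$ be the translation by $\lambda$, and let $k_i$ be the smallest positive integer with $k_i\omega_i^\vee\in Q^\vee$. An infinite word $\mathbf{i}=i_1i_2\cdots$ in $\{0,\dots,n\}$ is reduced if all the words $s_{i_1}\cdots s_{i_k}$ are reduced. Its inversion set is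 the set of reflections $s_{i_1}\cdots s_{i_{a-1}}s_{i_a}s_{i_{a-1}}\cdots s_{i_1}$, $a\ge 1$. Let $[\mathbf{i}]$ be the class of all infinite reduced words with the same inversion set as $\mathbf{i}$; the limit weak order $\widetilde{\mathcal W}$ is the set of these classes, ordered by containment of inversion sets. For $g\in\widetilde W$ with a nonempty reduced word $l$ such that the infinite word $l\,l\,l\cdots$ is reduced, write $[g^\infty]$ for the class of $l\,l\,l\cdots$. The node $\alpha_i$ ($1\le i\le n$) is a Coxeter node if $[t_{wk_i\omega_i^\vee}^\infty]=[c^\infty]$ for some $w\in W$ and some Coxeter element $c$ of $\widetilde W$. Then: 1. A Coxeter node exists. 2. If $\Phi$ is not of type $A_n$, the Coxeter node is unique; if $\Phi$ is of type $A_n$ (that is, if $\widetilde W$ is an affine symmetric group), every node $\alpha_1,\dots,\alpha_n$ is a Coxeter node. 3. For every Coxeter element $c$ of $\widetilde W$, the class $[c^\infty]$ exists, does not depend on the choice of the reduced word of $c$, and is a minimal element of $\widetilde{\mathcal W}$. -/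

import Mathlib

/-!
Infinite reduced words, limit elements and the limit weak order for a group `G` with a family
of generators `s : B → G`; the affine Weyl group of a root system; Coxeter nodes.
-/

namespace LimitWeak

section Words

variable {G B : Type*} [Group G] (s : B → G)

/-- The element `s_{i₁} ⋯ s_{iₖ}` represented by a word. -/
def wordProd (l : List B) : G := (l.map s).prod

/-- A word is reduced if no shorter word represents the same element. -/
def IsReducedWord (l : List B) : Prop :=
  ∀ l' : List B, wordProd s l' = wordProd s l → l.length ≤ l'.length

/-- The prefix of length `k` of an infinite word. -/
def initialWord (i : ℕ → B) (k : ℕ) : List B := (List.range k).map i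

/-- An infinite word is reduced if all of its finite prefixes are reduced. -/
def IsInfReducedWord (i : ℕ → B) : Prop := ∀ k, IsReducedWord s (initialWord i k)

/-- The inversion set of an infinite word, as a set of reflections: it consists of the elements
`s_{i₁} ⋯ s_{iₐ₋₁} s_{iₐ} s_{iₐ₋₁} ⋯ s_{i₁}`. -/
def infInv (i : ℕ → B) : Set G :=
  Set.range fun a : ℕ =>
    wordProd s (initialWord i a) * s (i a) * (wordProd s (initialWord i a))⁻¹

/-- Infinite reduced words. -/
def InfReducedWord : Type _ := {i : ℕ → B // IsInfReducedWord s i}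

/-- Infinite reduced words are equivalent if they have the same inversion set. -/
def limitSetoid : Setoid (InfReducedWord s) where
  r i j := infInv s i.1 = infInv s j.1
  iseqv := ⟨fun _ => rfl, fun h => h.symm, fun h h' => h.trans h'⟩

/-- Limit elements: equivalence classes of infinite reduced words. -/
def LimitElement : Type _ := Quotient (limitSetoid s)

/-- The class `[i]` of an infinite reduced word. -/
def limitMk (i : ℕ → B) (hi : IsInfReducedWord s i) : LimitElement s :=
  Quotient.mk (limitSetoid s) ⟨i, hi⟩

/-- The inversion set of a limit element. -/
def LimitElement.inv (x : LimitElement s) : Set G :=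
  Quotient.lift (s := limitSetoid s) (fun i => infInv s i.1) (fun _ _ h => h) x

theorem LimitElement.inv_injective : Function.Injective (LimitElement.inv s) := by
  intro x y h
  induction x using Quotient.inductionOn with
  | _ i =>
    induction y using Quotient.inductionOn with
    | _ j => exact Quotient.sound h

/-- The limit weak order: containment of inversion sets. -/
instance : PartialOrder (LimitElement s) :=
  PartialOrder.lift (LimitElement.inv s) (LimitElement.inv_injective s)

/-- The infinite word `l l l ⋯`. -/
def periodicWord (l : List B) (hl : 0 < l.length) : ℕ → B :=
  fun k => l.get ⟨k % l.length, Nat.mod_lt k hl⟩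

/-- `x = [g^∞]`: for some reduced word `l` of `g`, the infinite word `l l l ⋯` is reduced and its
class is `x`. -/
def IsInfPower (g : G) (x : LimitElement s) : Prop :=
  ∃ (l : List B) (hl : 0 < l.length) (h : IsInfReducedWord s (periodicWord l hl)),
    wordProd s l = g ∧ IsReducedWord s l ∧ limitMk s (periodicWord l hl) h = x

/-- A Coxeter element: the product of all the generators, each taken once, in some order. -/
def IsCoxeterElement (c : G) : Prop :=
  ∃ l : List B, l.Nodup ∧ (∀ i, i ∈ l) ∧ wordProd s l = c

end Words

section Affine

variable {ι M N : Type*} [AddCommGroup M] [Module ℝ M] [AddCommGroup N] [Module ℝ N]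

/-- The affine reflection `x ↦ x - (⟨α, x⟩ - k) α^∨` of the coweight space across the hyperplane
`⟨α, x⟩ = k`, where `α` is the root of index `i`. -/
noncomputable def affRefl (P : RootPairing ι ℝ M N) (i : ι) (k : ℤ) : N ≃ᵃ[ℝ] N :=
  AffineEquiv.constVAdd ℝ N (k • P.coroot i) * (P.coreflection i).toAffineEquiv

theorem affRefl_apply (P : RootPairing ι ℝ M N) (i : ι) (k : ℤ) (x : N) :
    affRefl P i k x = x - (P.toLinearMap (P.root i) x - (k : ℝ)) • P.coroot i := by
  simp only [affRefl, AffineEquiv.mul_def, AffineEquiv.trans_apply, AffineEquiv.constVAdd_apply,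
    LinearEquiv.coe_toAffineEquiv, RootPairing.coreflection_apply, vadd_eq_add, sub_smul]
  rw [Int.cast_smul_eq_zsmul]
  abel

/-- The affine Weyl group, acting on the coweight space: it is generated by the reflections across
the hyperplanes `⟨α, x⟩ = k`, for all roots `α` and all integers `k`. -/
def affWeyl (P : RootPairing ι ℝ M N) : Subgroup (N ≃ᵃ[ℝ] N) :=
  Subgroup.closure (Set.range fun a : ι × ℤ => affRefl P a.1 a.2)

/-- The finite Weyl group, acting linearly on the coweight space. -/
def finWeyl (P : RootPairing ι ℝ M N) : Subgroup (N ≃ₗ[ℝ] N) :=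
  Subgroup.closure (Set.range P.coreflection)

theorem nonempty_index (P : RootPairing ι ℝ M N) [P.IsRootSystem] [P.IsIrreducible] :
    Nonempty ι := by
  by_contra h
  rw [not_nonempty_iff] at h
  have : Nontrivial M := RootPairing.IsIrreducible.nontrivial P
  have h1 := RootPairing.IsRootSystem.span_root_eq_top (P := P)
  rw [Set.range_eq_empty, Submodule.span_empty] at h1
  exact bot_ne_top h1

variable {P : RootPairing ι ℝ M N} (b : P.Base)

theorem exists_max_height [Finite ι] [P.IsRootSystem] [P.IsReduced] [P.IsIrreducible] :
    ∃ θ : ι, ∀ j, b.height j ≤ b.height θ :=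
  have := nonempty_index P
  Finite.exists_max b.height

/-- (The index of) the highest root: the root of maximal height. -/
noncomputable def highestRoot [Finite ι] [P.IsRootSystem] [P.IsReduced] [P.IsIrreducible] : ι :=
  (exists_max_height b).choose

/-- The simple reflections of the affine Weyl group. The affine node is `none`: `s₀` is the
reflection across `⟨ξ, x⟩ = 1`, with `ξ` the highest root. For a simple root `αᵢ`, `sᵢ` is the
reflection across `⟨αᵢ, x⟩ = 0`. -/
noncomputable def simpleRefl [Finite ι] [P.IsRootSystem] [P.IsReduced] [P.IsIrreducible] :
    Option b.support → affWeyl P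
  | none => ⟨affRefl P (highestRoot b) 1, Subgroup.subset_closure ⟨(highestRoot b, 1), rfl⟩⟩
  | some i => ⟨affRefl P i 0, Subgroup.subset_closure ⟨((i : ι), 0), rfl⟩⟩

/-- The coroot lattice. -/
def corootLattice : Submodule ℤ N := Submodule.span ℤ (P.coroot '' b.support)

/-- The fundamental coweights: the basis dual to the simple roots. -/
noncomputable def fundCoweight [P.IsRootSystem] (i : b.support) : N :=
  P.toLinearMap.flip.toPerfPair.symm (b.toWeightBasis.coord i)

open Classical in
theorem root_fundCoweight [P.IsRootSystem] (i j : b.support) :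
    P.toLinearMap (P.root i) (fundCoweight b j) = if i = j then 1 else 0 := by
  rw [fundCoweight, LinearMap.apply_toPerfPair_flip, ← b.toWeightBasis_apply,
    Module.Basis.coord_apply, Module.Basis.repr_self, Finsupp.single_apply]

/-- The smallest positive integer `k` such that `k ωᵢ^∨` lies in the coroot lattice. -/
noncomputable def coweightIndex [P.IsRootSystem] (i : b.support) : ℕ :=
  sInf {k : ℕ | 0 < k ∧ k • fundCoweight b i ∈ corootLattice b}

/-- The simple root `αᵢ` is a Coxeter node if `[t^∞] = [c^∞]` for some Coxeter element `c`, where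
`t` is the translation by `w (kᵢ ωᵢ^∨)` for some `w` in the finite Weyl group. -/
def IsCoxeterNode [Finite ι] [P.IsRootSystem] [P.IsReduced] [P.IsIrreducible]
    (i : b.support) : Prop :=
  ∃ w ∈ finWeyl P, ∃ t c : affWeyl P, ∃ x : LimitElement (simpleRefl b),
    (t : N ≃ᵃ[ℝ] N) = AffineEquiv.constVAdd ℝ N (w (coweightIndex b i • fundCoweight b i)) ∧
    IsCoxeterElement (simpleRefl b) c ∧
    IsInfPower (simpleRefl b) t x ∧ IsInfPower (simpleRefl b) c x

/-- The root system is of type `A_n` for some `n`, i.e. the affine Weyl group is an affine symmetric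
group. -/
def IsTypeA [P.IsCrystallographic] : Prop :=
  ∃ (n : ℕ) (e : b.support ≃ Fin n), ∀ i j, b.cartanMatrix i j = CartanMatrix.A n (e i) (e j)

end Affine

end LimitWeak

set_option linter.unusedSectionVars false

namespace LimitWeak

/-! ### Finite root systems: coordinates on simple roots and the highest root. -/

section RootSystem

variable {ι M N : Type*} [Finite ι] [AddCommGroup M] [Module ℝ M] [AddCommGroup N] [Module ℝ N]
  {P : RootPairing ι ℝ M N} [P.IsRootSystem] [P.IsCrystallographic] [P.IsReduced]
  [P.IsIrreducible] (b : P.Base)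

/-! A reflection is encoded by the affine root f(x) = ⟨α, x⟩ - k that vanishes on its wall and is
positive at a base point of the fundamental alcove. A word is a gallery of alcoves, and it is
reduced exactly when every root `galRoot` attached to a crossed wall is positive at the base point.
If g^m is the translation by v and the periodic word of g is reduced, the walls crossed are
precisely those whose positive root decreases along v (`range_galRoot_periodicWord`). Hence [g^∞]
depends only on the signs of the finite roots on v, and every question becomes one about directions
v.

For a Coxeter element c, one looks for v along which the successive wall roots vary by minus the
comarks. This is a triangular system prescribing the n + 1 linear parts of the simple affine roots
on v. These satisfy one linear relation Σ mᵢaᵢ = 0, and the resulting compatibility condition is the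
vanishing of -½|Σ mᵢaᵢ|², so it holds (`exists_chain_values`). The comark relation between the
coroots shows that c fixes v, and the uniqueness of that relation shows that c fixes only the line
ℝv. So the gallery of c is reduced, and [c^∞] is the class of the ray of v. A vector spanning the
fixed space of a finite Weyl group element lies on the ray of some wωᵢ^∨
(`exists_eq_smul_fundCoweight`), which yields a Coxeter node. The roots orthogonal to such a ray cut
out exactly its line, so a gallery with strictly fewer inversions would stay bounded; this is
minimality (`isMin_of_inv_eq_rayRoots`).

Outside type A the affine diagram is a forest: on a set of vertices each with two neighbours in the
set, the sum of the normalized simple roots has nonpositive square norm, which forces the whole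
diagram to be a simply laced cycle. In a forest all Coxeter elements are conjugate by rotations and
commutations, so their directions have conjugate sign patterns, and uniqueness of dominant
representatives identifies the nodes. In type A, a word starting with s₀ and then moving along the
path from both ends towards node i has direction ωᵢ^∨, so every node occurs. -/

theorem toLinearMap_fundCoweight (m : M) (i : b.support) :
    P.toLinearMap m (fundCoweight b i) = b.toWeightBasis.repr m i := by
  rw [fundCoweight, LinearMap.apply_toPerfPair_flip, Module.Basis.coord_apply]

theorem sum_fundCoweight_smul_root (m : M) :
    ∑ i : b.support, P.toLinearMap m (fundCoweight b i) • P.root i = m := by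
  conv_rhs => rw [← b.toWeightBasis.sum_repr m]
  simp [toLinearMap_fundCoweight]

theorem coweight_ext {v w : N}
    (h : ∀ i : b.support, P.toLinearMap (P.root i) v = P.toLinearMap (P.root i) w) : v = w := by
  have : P.toLinearMap.flip v = P.toLinearMap.flip w :=
    b.toWeightBasis.ext fun i => by simpa using h i
  exact P.toLinearMap.flip.toPerfPair.injective (by simpa using this)

theorem exists_int_coords (j : ι) : ∃ f : b.support → ℤ,
    (∀ i, P.toLinearMap (P.root j) (fundCoweight b i) = f i) ∧
      ((∀ i, 0 ≤ f i) ∨ ∀ i, f i ≤ 0) := by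
  obtain ⟨f, -, h, hf⟩ := b.exists_root_eq_sum_int j
  refine ⟨fun i => f i, fun i => ?_, h.imp (fun h i => h.le i) (fun h i => h.le i)⟩
  classical
  rw [hf]
  rw [← Finset.sum_coe_sort b.support]
  simp [root_fundCoweight]

theorem height_eq_sum_coords (j : ι) :
    (b.height j : ℝ) = ∑ i, P.toLinearMap (P.root j) (fundCoweight b i) := by
  classical
  obtain ⟨f, -, -, hf⟩ := b.exists_root_eq_sum_int j
  rw [RootPairing.Base.height_eq_sum hf, hf, ← Finset.sum_coe_sort b.support,
    ← Finset.sum_coe_sort b.support]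
  simp [root_fundCoweight]

theorem coords_nonneg_of_isPos {j : ι} (hj : b.IsPos j) (i : b.support) :
    0 ≤ P.toLinearMap (P.root j) (fundCoweight b i) := by
  obtain ⟨f, hf, h | h⟩ := exists_int_coords b j
  · rw [hf]; exact_mod_cast h i
  · exfalso
    have h1 : (0 : ℝ) < b.height j := by exact_mod_cast hj
    rw [height_eq_sum_coords] at h1
    refine absurd h1 (not_lt.2 (Finset.sum_nonpos fun i _ => ?_))
    rw [hf]; exact_mod_cast h i

theorem coords_nonpos_of_not_isPos {j : ι} (hj : ¬ b.IsPos j) (i : b.support) :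
    P.toLinearMap (P.root j) (fundCoweight b i) ≤ 0 := by
  obtain ⟨f, hf, h | h⟩ := exists_int_coords b j
  · exfalso
    refine hj ((b.isPos_iff').2 ?_)
    have : (0 : ℝ) ≤ b.height j := by
      rw [height_eq_sum_coords]
      refine Finset.sum_nonneg fun i _ => ?_
      rw [hf]; exact_mod_cast h i
    exact_mod_cast this
  · rw [hf]; exact_mod_cast h i

theorem height_le_highestRoot (j : ι) : b.height j ≤ b.height (highestRoot b) :=
  (exists_max_height b).choose_spec j

theorem support_nonempty : Nonempty b.support := by
  have := nonempty_index P
  exact b.support_nonempty.to_subtype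

theorem highestRoot_height_pos : 0 < b.height (highestRoot b) := by
  obtain ⟨i⟩ := support_nonempty b
  have := height_le_highestRoot b i
  rw [RootPairing.Base.height_one_of_mem_support i.2] at this
  omega

/-- A positive root from which no simple root can be added is dominant. -/
theorem pairing_nonneg_of_add_notMem {j : ι} (hj : b.IsPos j)
    (h : ∀ i ∈ b.support, P.root j + P.root i ∉ Set.range P.root) (i : b.support) :
    0 ≤ P.pairing j i := by
  by_contra hneg
  push Not at hneg
  have h1 : P.pairingIn ℤ j i < 0 := by
    have := P.algebraMap_pairingIn ℤ j i
    rw [← this] at hneg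
    simpa using hneg
  refine h i i.2 (P.root_add_root_mem_of_pairingIn_neg h1 fun h2 => ?_)
  have h3 := coords_nonneg_of_isPos b hj i
  rw [h2] at h3
  simp [root_fundCoweight] at h3
  linarith

theorem pairing_eq_sum_coords (j k : ι) : P.pairing j k =
    ∑ i : b.support, P.toLinearMap (P.root j) (fundCoweight b i) * P.pairing i k := by
  conv_lhs => rw [← P.root_coroot_eq_pairing, ← sum_fundCoweight_smul_root b (P.root j)]
  simp

theorem pairing_nonpos_of_ne {i j : b.support} (h : i ≠ j) : P.pairing i j ≤ 0 := by
  have := b.pairingIn_le_zero_of_ne (fun h' => h (Subtype.ext h')) i.2 j.2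
  rw [← P.algebraMap_pairingIn ℤ]
  simpa using this

/-- The Dynkin diagram is connected: if some coordinate vanished, there would be a node l outside
the support of the root adjacent to a node k inside it, and every term of the pairing with l would
be nonpositive, the k-term strictly negative. -/
theorem coords_pos_of_dominant {j : ι} (hj : b.IsPos j) (hd : ∀ i : b.support, 0 ≤ P.pairing j i)
    (i : b.support) : 0 < P.toLinearMap (P.root j) (fundCoweight b i) := by
  have h0 : ∃ k : b.support, 0 < P.toLinearMap (P.root j) (fundCoweight b k) := by
    by_contra! h
    have h1 : (0 : ℝ) < b.height j := by exact_mod_cast hj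
    rw [height_eq_sum_coords] at h1
    exact absurd h1 (not_lt.2 (Finset.sum_nonpos fun i _ => h i))
  obtain ⟨k, hk⟩ := h0
  refine b.induction_on_cartanMatrix
    (fun i => 0 < P.toLinearMap (P.root j) (fundCoweight b i)) hk fun k l hk hkl => ?_
  by_contra hl
  have hl0 : P.toLinearMap (P.root j) (fundCoweight b l) = 0 :=
    le_antisymm (not_lt.1 hl) (coords_nonneg_of_isPos b hj l)
  have hkl' : P.pairing k l ≠ 0 := by
    rwa [← b.cartanMatrix_apply_eq_zero_iff_pairing.ne, ne_eq,
      b.cartanMatrix_apply_eq_zero_iff_symm]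
  have hne : k ≠ l := by rintro rfl; exact absurd hl0 hk.ne'
  have : P.pairing j l < 0 := by
    rw [pairing_eq_sum_coords b]
    refine Finset.sum_neg' (fun i _ => ?_) ⟨k, Finset.mem_univ _, ?_⟩
    · by_cases hil : i = l
      · rw [hil, hl0, zero_mul]
      · exact mul_nonpos_of_nonneg_of_nonpos (coords_nonneg_of_isPos b hj i)
          (pairing_nonpos_of_ne b hil)
    · exact mul_neg_of_pos_of_neg hk (lt_of_le_of_ne (pairing_nonpos_of_ne b hne) hkl')
  exact absurd (hd l) (not_le.2 this)

/-- Adding a simple root raises the height by one. Maximality is required only among roots that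
dominate the given one, so that the lemma also serves inside the upper set used in
`coords_le_highestRoot`. -/
theorem add_notMem_of_height_max {j : ι}
    (h : ∀ k, (∀ i, P.toLinearMap (P.root j) (fundCoweight b i) ≤
      P.toLinearMap (P.root k) (fundCoweight b i)) → b.height k ≤ b.height j) :
    ∀ i ∈ b.support, P.root j + P.root i ∉ Set.range P.root := by
  classical
  rintro i hi ⟨k, hk⟩
  have h1 := b.height_add hk
  rw [RootPairing.Base.height_one_of_mem_support hi] at h1
  have h2 := h k fun l => by
    rw [hk, map_add, LinearMap.add_apply]
    have := coords_nonneg_of_isPos b (b.isPos_of_mem_support hi) l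
    linarith
  omega

theorem highestRoot_isPos : b.IsPos (highestRoot b) := highestRoot_height_pos b

theorem pairing_highestRoot_nonneg (i : b.support) : 0 ≤ P.pairing (highestRoot b) i :=
  pairing_nonneg_of_add_notMem b (highestRoot_isPos b)
    (add_notMem_of_height_max b fun k _ => height_le_highestRoot b k) i

theorem coords_highestRoot_pos (i : b.support) :
    0 < P.toLinearMap (P.root (highestRoot b)) (fundCoweight b i) :=
  coords_pos_of_dominant b (highestRoot_isPos b) (pairing_highestRoot_nonneg b) i

theorem pairing_nonneg_symm {i j : ι} (h : 0 ≤ P.pairing i j) : 0 ≤ P.pairing j i := by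
  rw [← P.algebraMap_pairingIn ℤ] at h ⊢
  have h : 0 ≤ P.pairingIn ℤ i j := by simpa using h
  by_contra hn
  have h2 : P.pairingIn ℤ j i < 0 := by simpa using hn
  rw [P.pairingIn_lt_zero_iff ℤ] at h2
  omega

/-- The highest root dominates all roots coordinatewise. -/
theorem coords_le_highestRoot (j : ι) (i : b.support) :
    P.toLinearMap (P.root j) (fundCoweight b i) ≤
      P.toLinearMap (P.root (highestRoot b)) (fundCoweight b i) := by
  classical
  by_cases hj : b.IsPos j
  swap
  · exact (coords_nonpos_of_not_isPos b hj i).trans (coords_highestRoot_pos b i).le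
  set θ := highestRoot b with hθ
  -- Take η of maximal height among the roots dominating j. If η ≠ θ, the positive pairing makes θ -
  -- η a root; it is positive by heights, so θ also lies in `S` with greater height.
  let S : Set ι := {k | ∀ i, P.toLinearMap (P.root j) (fundCoweight b i) ≤
      P.toLinearMap (P.root k) (fundCoweight b i)}
  obtain ⟨η, hηS, hη⟩ := Set.exists_max_image S b.height (Set.toFinite _) ⟨j, fun _ => le_rfl⟩
  suffices η = θ by rw [← this]; exact hηS i
  have hpos : b.IsPos η := by
    have h1 : b.height j ≤ b.height η := hη j fun _ => le_rfl
    exact lt_of_lt_of_le hj h1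
  have hdom := pairing_nonneg_of_add_notMem b hpos
    (add_notMem_of_height_max b fun k hk => hη k fun i => (hηS i).trans (hk i))
  have hco := coords_pos_of_dominant b hpos hdom
  have hθi : ∀ i : b.support, 0 ≤ P.pairing i θ := fun i =>
    pairing_nonneg_symm (pairing_highestRoot_nonneg b i)
  have hpair : 0 < P.pairing η θ := by
    rw [pairing_eq_sum_coords b]
    obtain ⟨k, hk⟩ : ∃ k : b.support, 0 < P.pairing k θ := by
      by_contra! h
      have h2 : P.pairing θ θ = 0 := by
        rw [pairing_eq_sum_coords b]
        exact Finset.sum_eq_zero fun i _ => by rw [le_antisymm (h i) (hθi i), mul_zero]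
      rw [P.pairing_same] at h2
      norm_num at h2
    exact Finset.sum_pos' (fun i _ => mul_nonneg (hco i).le (hθi i))
      ⟨k, Finset.mem_univ _, mul_pos (hco k) hk⟩
  by_contra hne
  have hpair' : 0 < P.pairingIn ℤ η θ := by
    rw [← P.algebraMap_pairingIn ℤ] at hpair
    simpa using hpair
  obtain ⟨γ, hγ⟩ := P.root_sub_root_mem_of_pairingIn_pos ((P.zero_lt_pairingIn_iff' ℤ).1 hpair')
    (Ne.symm hne)
  have hh := b.height_sub hγ
  have hle : b.height η ≤ b.height θ := height_le_highestRoot b η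
  have hγ0 := b.height_ne_zero γ
  have hγpos : b.IsPos γ := by
    rw [RootPairing.Base.isPos_iff]; omega
  have : b.height θ ≤ b.height η := hη θ fun i => by
    have h1 := coords_nonneg_of_isPos b hγpos i
    rw [hγ, map_sub, LinearMap.sub_apply] at h1
    have h2 := hηS i
    linarith
  have : 0 < b.height γ := hγpos
  omega

end RootSystem

/-! ### Affine roots and the fundamental alcove. -/

section AffineRoots

variable {ι M N : Type*} [Finite ι] [AddCommGroup M] [Module ℝ M] [AddCommGroup N] [Module ℝ N]

/-- The affine root `x ↦ ⟨α, x⟩ - k`, where `α` is the root of index `j`. -/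
def affVal (P : RootPairing ι ℝ M N) (j : ι) (k : ℤ) (x : N) : ℝ :=
  P.toLinearMap (P.root j) x - (k : ℝ)

/-- A function on the coweight space is an affine root if it is `x ↦ ⟨α, x⟩ - k` for a root `α`
and an integer `k`. -/
def IsAffRoot (P : RootPairing ι ℝ M N) (f : N → ℝ) : Prop := ∃ j k, f = affVal P j k

variable {P : RootPairing ι ℝ M N}

theorem affVal_add (j : ι) (k : ℤ) (x v : N) :
    affVal P j k (x + v) = affVal P j k x + P.toLinearMap (P.root j) v := by
  simp only [affVal, map_add]; ring

theorem affVal_zero (j : ι) (k : ℤ) : affVal P j k 0 = -k := by simp [affVal]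

theorem linear_affRefl (j : ι) (k : ℤ) (v : N) :
    (affRefl P j k).linear v = v - P.toLinearMap (P.root j) v • P.coroot j := by
  have h := (affRefl P j k).map_vadd 0 v
  simp only [vadd_eq_add, add_zero, affRefl_apply] at h
  rw [← sub_eq_iff_eq_add] at h
  rw [← h, map_zero]
  module

theorem affineEquiv_apply_add (g : N ≃ᵃ[ℝ] N) (x v : N) : g (x + v) = g x + g.linear v := by
  have := g.map_vadd x v
  rw [vadd_eq_add, vadd_eq_add] at this
  rw [add_comm x, this, add_comm]

variable [P.IsRootSystem] [P.IsCrystallographic] [P.IsReduced] [P.IsIrreducible] (b : P.Base)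

/-- The linear parts of the simple affine roots. -/
noncomputable def aroot : Option b.support → M
  | none => -P.root (highestRoot b)
  | some i => P.root i

/-- The coroots of the simple affine roots. -/
noncomputable def acoroot : Option b.support → N
  | none => -P.coroot (highestRoot b)
  | some i => P.coroot i

/-- The simple affine roots. -/
noncomputable def sval : Option b.support → N → ℝ
  | none => fun x => 1 - P.toLinearMap (P.root (highestRoot b)) x
  | some i => fun x => P.toLinearMap (P.root i) x

theorem sval_add (i : Option b.support) (x v : N) :
    sval b i (x + v) = sval b i x + P.toLinearMap (aroot b i) v := by
  cases i <;> simp [sval, aroot]; ring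

theorem simpleRefl_apply (i : Option b.support) (x : N) :
    (simpleRefl b i).1 x = x - sval b i x • acoroot b i := by
  cases i with
  | none =>
    simp only [simpleRefl, affRefl_apply, sval, acoroot]
    module
  | some i => simp [simpleRefl, affRefl_apply, sval, acoroot]

theorem exists_affVal_eq_sval (i : Option b.support) : ∃ j k,
    sval b i = affVal P j k ∧ acoroot b i = P.coroot j ∧ aroot b i = P.root j ∧
      (simpleRefl b i).1 = affRefl P j k := by
  cases i with
  | none =>
    -- The function 1 - ⟨ξ, x⟩ is the affine root with linear part -ξ and k = -1; `reflectionPerm`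
    -- of an index at itself is the index of the opposite root.
    refine ⟨P.reflectionPerm (highestRoot b) (highestRoot b), -1, ?_, ?_, ?_, ?_⟩
    · ext x
      simp [sval, affVal]; ring
    · simp [acoroot]
    · simp [aroot]
    · ext x
      simp only [simpleRefl, affRefl_apply]
      simp
      module
  | some i => exact ⟨i, 0, by ext x; simp [sval, affVal], rfl, rfl, rfl⟩

theorem sval_isAffRoot (i : Option b.support) : IsAffRoot P (sval b i) := by
  obtain ⟨j, k, h, -⟩ := exists_affVal_eq_sval b i
  exact ⟨j, k, h⟩

theorem aroot_acoroot_self (i : Option b.support) :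
    P.toLinearMap (aroot b i) (acoroot b i) = 2 := by
  cases i <;> simp [aroot, acoroot]

theorem linear_simpleRefl (i : Option b.support) (v : N) :
    (simpleRefl b i).1.linear v = v - P.toLinearMap (aroot b i) v • acoroot b i := by
  obtain ⟨j, k, -, h1, h2, h3⟩ := exists_affVal_eq_sval b i
  rw [h3, h1, h2, linear_affRefl]

/-- The affine Weyl group permutes the affine roots. -/
theorem exists_affVal_comp {g : N ≃ᵃ[ℝ] N} (hg : g ∈ affWeyl P) : ∀ j k, ∃ j' k',
    (∀ x, affVal P j k (g x) = affVal P j' k' x) ∧ g.linear (P.coroot j') = P.coroot j := by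
  have key : ∀ i l j k, ∃ j' k', (∀ x, affVal P j k (affRefl P i l x) = affVal P j' k' x) ∧
      (affRefl P i l).linear (P.coroot j') = P.coroot j := by
    intro i l j k
    refine ⟨P.reflectionPerm i j, k - l * P.pairingIn ℤ j i, fun x => ?_, ?_⟩
    · have h1 : ((P.pairingIn ℤ j i : ℤ) : ℝ) = P.pairing j i := by
        rw [← P.algebraMap_pairingIn ℤ]; simp
      simp only [affVal, affRefl_apply, P.root_reflectionPerm, P.reflection_apply_root, map_sub,
        map_smul, LinearMap.sub_apply, LinearMap.smul_apply, P.root_coroot_eq_pairing, smul_eq_mul,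
        Int.cast_sub, Int.cast_mul, h1]
      ring
    · rw [linear_affRefl, ← P.coreflection_apply, ← P.coroot_reflectionPerm,
        P.reflectionPerm_self]
  induction hg using Subgroup.closure_induction'' with
  | mem x hx =>
    obtain ⟨⟨i, l⟩, rfl⟩ := hx
    exact key i l
  | inv_mem x hx =>
    obtain ⟨⟨i, l⟩, rfl⟩ := hx
    have : (affRefl P i l)⁻¹ = affRefl P i l := by
      rw [inv_eq_iff_mul_eq_one]
      ext x
      simp only [AffineEquiv.coe_mul, Function.comp_apply, affRefl_apply, map_sub, map_smul,
        P.root_coroot_eq_pairing, P.pairing_same, AffineEquiv.coe_one, id_eq, smul_eq_mul]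
      module
    rw [this]
    exact key i l
  | one => exact fun j k => ⟨j, k, fun x => rfl, rfl⟩
  | mul x y hx hy h1 h2 =>
    intro j k
    obtain ⟨j1, k1, h3, h4⟩ := h1 j k
    obtain ⟨j2, k2, h5, h6⟩ := h2 j1 k1
    refine ⟨j2, k2, fun z => ?_, ?_⟩
    · rw [← h5, ← h3]; rfl
    · rw [← h4, ← h6]; rfl

theorem IsAffRoot.comp {f : N → ℝ} (hf : IsAffRoot P f) (g : affWeyl P) :
    IsAffRoot P (fun x => f (g.1 x)) := by
  obtain ⟨j, k, rfl⟩ := hf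
  obtain ⟨j', k', h, -⟩ := exists_affVal_comp g.2 j k
  exact ⟨j', k', funext h⟩

theorem IsAffRoot.neg {f : N → ℝ} (hf : IsAffRoot P f) : IsAffRoot P (fun x => -f x) := by
  obtain ⟨j, k, rfl⟩ := hf
  exact ⟨P.reflectionPerm j j, -k, by ext x; simp [affVal]; ring⟩

/-- The linear parts are proportional, so in a reduced system they agree up to sign, and c ≥ 0
excludes the sign -1. -/
theorem affVal_eq_of_eq_mul {j j' : ι} {k k' : ℤ} {c : ℝ} (hc : 0 ≤ c)
    (h : ∀ x, affVal P j k x = c * affVal P j' k' x) : affVal P j k = affVal P j' k' := by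
  have h0 := h 0
  have hroot : P.root j = c • P.root j' := by
    apply P.toPerfPair.injective
    ext v
    have h1 := h v
    simp only [affVal, map_zero] at h0 h1
    simp only [LinearMap.toPerfPair_apply, map_smul, LinearMap.smul_apply, smul_eq_mul]
    linarith
  have hli : ¬ LinearIndependent ℝ ![P.root j, P.root j'] := by
    intro hli
    have := LinearIndependent.pair_iff.1 hli 1 (-c) (by rw [hroot]; module)
    exact one_ne_zero this.1
  rcases RootPairing.IsReduced.eq_or_eq_neg j j' hli with h1 | h1
  · have hc1 : c = 1 := by
      rw [h1] at hroot
      have : (c - 1) • P.root j' = 0 := by rw [sub_smul, ← hroot]; simp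
      rcases smul_eq_zero.1 this with h | h
      · linarith
      · exact absurd h (P.ne_zero j')
    ext x
    rw [h, hc1, one_mul]
  · exfalso
    rw [h1] at hroot
    have : (c + 1) • P.root j' = 0 := by rw [add_smul, ← hroot]; simp
    rcases smul_eq_zero.1 this with h | h
    · linarith
    · exact absurd h (P.ne_zero _)

/-- Every affine root is a combination of simple affine roots with coefficients of one sign. -/
theorem exists_eq_sum_sval {f : N → ℝ} (hf : IsAffRoot P f) : ∃ c : Option b.support → ℝ,
    (∀ x, f x = ∑ i, c i * sval b i x) ∧ ((∀ i, 0 ≤ c i) ∨ ∀ i, c i ≤ 0) := by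
  obtain ⟨j, k, rfl⟩ := hf
  set θ := highestRoot b with hθ
  let co : ι → b.support → ℝ := fun j i => P.toLinearMap (P.root j) (fundCoweight b i)
  -- The constant 1 is the affine simple root plus ξ; substituting this in α - k gives the
  -- coefficients. For k ≠ 0 the sign is decided by the domination of all roots by ξ, for k = 0 by
  -- the sign of α.
  refine ⟨fun i => i.elim (-k : ℝ) fun i => co j i - k * co θ i, fun x => ?_, ?_⟩
  · have h1 := congrArg (fun m => P.toLinearMap m x) (sum_fundCoweight_smul_root b (P.root j))
    have h2 := congrArg (fun m => P.toLinearMap m x) (sum_fundCoweight_smul_root b (P.root θ))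
    simp only [map_sum, map_smul, LinearMap.sum_apply, LinearMap.smul_apply, smul_eq_mul] at h1 h2
    simp only [Fintype.sum_option, Option.elim, sval, affVal, sub_mul, mul_assoc,
      Finset.sum_sub_distrib, ← Finset.mul_sum, co]
    rw [h1, h2]
    ring
  · have hθpos := fun i => coords_highestRoot_pos b i
    have hle := fun j i => coords_le_highestRoot b j i
    rcases lt_trichotomy k 0 with hk | hk | hk
    · left
      have hk' : (k : ℝ) ≤ -1 := by exact_mod_cast Int.le_sub_one_of_lt hk
      rintro (_ | i)
      · simp; linarith
      · have h1 := hle (P.reflectionPerm j j) i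
        simp only [P.root_reflectionPerm, P.reflection_apply_self, map_neg,
          LinearMap.neg_apply] at h1
        have h2 := hθpos i
        simp only [Option.elim, co, hθ]
        nlinarith
    · subst hk
      by_cases hj : b.IsPos j
      · left
        rintro (_ | i)
        · simp
        · simpa [co] using coords_nonneg_of_isPos b hj i
      · right
        rintro (_ | i)
        · simp
        · simpa [co] using coords_nonpos_of_not_isPos b hj i
    · right
      have hk' : (1 : ℝ) ≤ k := by exact_mod_cast hk
      rintro (_ | i)
      · simp; linarith
      · have h1 := hle j i
        have h2 := hθpos i
        simp only [Option.elim, co, hθ]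
        nlinarith

/-- The Coxeter number: one more than the height of the highest root. -/
noncomputable def coxNum : ℝ := b.height (highestRoot b) + 1

theorem coxNum_pos : 0 < coxNum b := by
  have : (0 : ℝ) < b.height (highestRoot b) := by exact_mod_cast highestRoot_height_pos b
  unfold coxNum; linarith

/-- A point of the fundamental alcove on which all simple affine roots take the same value. -/
noncomputable def basePt : N := (coxNum b)⁻¹ • ∑ i, fundCoweight b i

theorem sval_basePt (i : Option b.support) : sval b i (basePt b) = (coxNum b)⁻¹ := by
  classical
  have h := (coxNum_pos b).ne'
  cases i with
  | none =>
    simp only [sval, basePt, map_smul, map_sum, ← height_eq_sum_coords, smul_eq_mul]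
    field_simp
    simp [coxNum]
  | some i => simp [sval, basePt, root_fundCoweight]

theorem sval_basePt_pos (i : Option b.support) : 0 < sval b i (basePt b) := by
  rw [sval_basePt]; exact inv_pos.2 (coxNum_pos b)

/-- The vertices of the fundamental alcove. -/
noncomputable def vertex : Option b.support → N
  | none => 0
  | some i => (P.toLinearMap (P.root (highestRoot b)) (fundCoweight b i))⁻¹ • fundCoweight b i

theorem sval_vertex_self_pos (i : Option b.support) : 0 < sval b i (vertex b i) := by
  classical
  cases i with
  | none => simp [sval, vertex]
  | some i => simpa [sval, vertex, root_fundCoweight] using coords_highestRoot_pos b i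

theorem sval_vertex_of_ne {i j : Option b.support} (h : i ≠ j) : sval b i (vertex b j) = 0 := by
  classical
  rcases i with _ | i <;> rcases j with _ | j
  · exact absurd rfl h
  · simp [sval, vertex, (coords_highestRoot_pos b j).ne']
  · simp [sval, vertex]
  · have : i ≠ j := fun h' => h (by rw [h'])
    simp [sval, vertex, root_fundCoweight, this]

theorem IsAffRoot.exists_nonneg {f : N → ℝ} (hf : IsAffRoot P f) (h : 0 ≤ f (basePt b)) :
    ∃ c : Option b.support → ℝ, (∀ x, f x = ∑ i, c i * sval b i x) ∧ ∀ i, 0 ≤ c i := by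
  obtain ⟨c, hc, h1 | h1⟩ := exists_eq_sum_sval b hf
  · exact ⟨c, hc, h1⟩
  · refine ⟨c, hc, fun i => ?_⟩
    rw [hc] at h
    by_contra hi
    refine absurd h (not_le.2 (Finset.sum_neg' (fun i _ => ?_) ⟨i, Finset.mem_univ _, ?_⟩))
    · exact mul_nonpos_of_nonpos_of_nonneg (h1 i) (sval_basePt_pos b i).le
    · exact mul_neg_of_neg_of_pos (not_le.1 hi) (sval_basePt_pos b i)

/-- An affine root that is nonnegative at the base point is nonnegative on the closed alcove. -/
theorem IsAffRoot.nonneg_of_mem_alcove {f : N → ℝ} (hf : IsAffRoot P f) (h : 0 ≤ f (basePt b))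
    {x : N} (hx : ∀ i, 0 ≤ sval b i x) : 0 ≤ f x := by
  obtain ⟨c, hc, hc0⟩ := hf.exists_nonneg b h
  rw [hc]
  exact Finset.sum_nonneg fun i _ => mul_nonneg (hc0 i) (hx i)

theorem IsAffRoot.nonpos_of_mem_alcove {f : N → ℝ} (hf : IsAffRoot P f) (h : f (basePt b) ≤ 0)
    {x : N} (hx : ∀ i, 0 ≤ sval b i x) : f x ≤ 0 := by
  have := hf.neg.nonneg_of_mem_alcove b (by linarith) hx
  linarith

theorem vertex_mem_alcove (i j : Option b.support) : 0 ≤ sval b i (vertex b j) := by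
  by_cases h : i = j
  · rw [h]; exact (sval_vertex_self_pos b j).le
  · rw [sval_vertex_of_ne b h]

/-- No wall meets the open alcove: a vanishing value would kill all the coefficients, and a zero
function is not an affine root since ⟨α, α^∨⟩ = 2. -/
theorem IsAffRoot.apply_basePt_ne_zero {f : N → ℝ} (hf : IsAffRoot P f) : f (basePt b) ≠ 0 := by
  intro h
  obtain ⟨c, hc, hc0⟩ := hf.exists_nonneg b h.ge
  have h0 : ∀ i, c i = 0 := fun i => by
    rw [hc, Finset.sum_eq_zero_iff_of_nonneg
      fun i _ => mul_nonneg (hc0 i) (sval_basePt_pos b i).le] at h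
    have := h i (Finset.mem_univ _)
    exact (mul_eq_zero.1 this).resolve_right (sval_basePt_pos b i).ne'
  obtain ⟨j, k, rfl⟩ := hf
  have hz : ∀ x, affVal P j k x = 0 := fun x => by simp [hc, h0]
  have h2 := affVal_add (P := P) j k 0 (P.coroot j)
  rw [hz, hz] at h2
  simp at h2

/-- A simple reflection changes the sign of no positive affine root but its own. -/
theorem IsAffRoot.eq_sval_of_flip {f : N → ℝ} (hf : IsAffRoot P f) {i : Option b.support}
    (h1 : 0 < f (basePt b)) (h2 : f ((simpleRefl b i).1 (basePt b)) < 0) : f = sval b i := by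
  classical
  obtain ⟨c, hc, hc0⟩ := hf.exists_nonneg b h1.le
  -- The vertex opposite wall j lies on wall i, hence is fixed by the reflection; there f is both
  -- nonnegative and nonpositive, while only its j-th term survives.
  have hz : ∀ j, j ≠ i → c j = 0 := by
    intro j hj
    have hv : f (vertex b j) = c j * sval b j (vertex b j) := by
      rw [hc, Finset.sum_eq_single j]
      · intro k _ hk; rw [sval_vertex_of_ne b hk, mul_zero]
      · simp
    have h3 := (hf.comp (simpleRefl b i)).nonpos_of_mem_alcove b h2.le
      (fun k => vertex_mem_alcove b k j)
    rw [simpleRefl_apply, sval_vertex_of_ne b hj.symm, zero_smul, sub_zero, hv] at h3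
    have h4 := sval_vertex_self_pos b j
    have := hc0 j
    nlinarith
  have hfi : ∀ x, f x = c i * sval b i x := fun x => by
    rw [hc, Finset.sum_eq_single i]
    · intro k _ hk; rw [hz k hk, zero_mul]
    · simp
  obtain ⟨j, k, rfl⟩ := hf
  obtain ⟨j', k', h⟩ := sval_isAffRoot b i
  rw [h] at hfi ⊢
  exact affVal_eq_of_eq_mul (hc0 i) hfi

theorem sval_simpleRefl (i : Option b.support) (x : N) :
    sval b i ((simpleRefl b i).1 x) = -sval b i x := by
  rw [simpleRefl_apply, sub_eq_add_neg, sval_add, map_neg, map_smul, aroot_acoroot_self,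
    smul_eq_mul]
  ring

theorem simpleRefl_mul_self (i : Option b.support) : simpleRefl b i * simpleRefl b i = 1 := by
  ext x
  change (simpleRefl b i).1 ((simpleRefl b i).1 x) = x
  rw [simpleRefl_apply, sval_simpleRefl, simpleRefl_apply]
  module

theorem simpleRefl_inv (i : Option b.support) : (simpleRefl b i)⁻¹ = simpleRefl b i :=
  inv_eq_of_mul_eq_one_left (simpleRefl_mul_self b i)

end AffineRoots

/-! ### Words, prefixes and periodic words. -/

section WordLemmas

variable {G B : Type*} [Group G] (s : B → G)

theorem wordProd_append (l l' : List B) : wordProd s (l ++ l') = wordProd s l * wordProd s l' := by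
  simp [wordProd]

theorem wordProd_cons (i : B) (l : List B) : wordProd s (i :: l) = s i * wordProd s l := by
  simp [wordProd]

theorem wordProd_singleton (i : B) : wordProd s [i] = s i := by simp [wordProd]

theorem wordProd_nil : wordProd s [] = 1 := rfl

theorem initialWord_succ (u : ℕ → B) (k : ℕ) : initialWord u (k + 1) = initialWord u k ++ [u k] := by
  simp [initialWord, List.range_succ]

theorem length_initialWord (u : ℕ → B) (k : ℕ) : (initialWord u k).length = k := by
  simp [initialWord]

theorem initialWord_add (u : ℕ → B) (m k : ℕ) :
    initialWord u (m + k) = initialWord u m ++ initialWord (fun n => u (m + n)) k := by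
  simp [initialWord, List.range_add, Function.comp_def]

variable {s} in
theorem IsReducedWord.of_append {l l' : List B} (h : IsReducedWord s (l ++ l')) :
    IsReducedWord s l := by
  intro m hm
  have := h (m ++ l') (by rw [wordProd_append, wordProd_append, hm])
  simpa using this

theorem exists_isReducedWord (l : List B) :
    ∃ l', wordProd s l' = wordProd s l ∧ IsReducedWord s l' := by
  classical
  have hex : ∃ n, ∃ l', wordProd s l' = wordProd s l ∧ l'.length = n := ⟨_, l, rfl, rfl⟩
  obtain ⟨l', h1, h2⟩ := Nat.find_spec hex
  refine ⟨l', h1, fun m hm => ?_⟩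
  rw [h2]
  exact Nat.find_min' hex ⟨m, hm.trans h1, rfl⟩

variable {s} in
/-- A word whose inversion sequence has a repetition is not reduced. -/
theorem not_isReducedWord_of_conj_eq (hs : ∀ i, s i * s i = 1) {u : ℕ → B} {q r : ℕ} (hqr : q < r)
    (h : wordProd s (initialWord u q) * s (u q) * (wordProd s (initialWord u q))⁻¹ =
      wordProd s (initialWord u r) * s (u r) * (wordProd s (initialWord u r))⁻¹) :
    ¬ IsReducedWord s (initialWord u (r + 1)) := by
  intro hred
  obtain ⟨k, rfl⟩ := Nat.exists_eq_add_of_lt hqr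
  -- `v` consists of the letters strictly between positions q and r. Equality of the two reflections
  -- allows the letters at q and r to be deleted together.
  set v := initialWord (fun n => u (q + 1 + n)) k with hv
  have hr : wordProd s (initialWord u (q + k + 1)) =
      wordProd s (initialWord u q) * s (u q) * wordProd s v := by
    rw [show q + k + 1 = (q + 1) + k by ring, initialWord_add, wordProd_append, initialWord_succ,
      wordProd_append, wordProd_singleton]
  have h2 : wordProd s (initialWord u (q + k + 1 + 1)) = wordProd s (initialWord u q ++ v) := by
    have h3 : wordProd s (initialWord u (q + k + 1 + 1)) =
        wordProd s (initialWord u (q + k + 1)) * s (u (q + k + 1)) *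
          (wordProd s (initialWord u (q + k + 1)))⁻¹ * wordProd s (initialWord u (q + k + 1)) := by
      rw [initialWord_succ u (q + k + 1), wordProd_append, wordProd_singleton,
        inv_mul_cancel_right]
    rw [h3, ← h, hr, wordProd_append]
    have h4 := hs (u q)
    calc _ = wordProd s (initialWord u q) * (s (u q) * s (u q)) * wordProd s v := by group
      _ = _ := by rw [h4, mul_one]
  have := hred _ h2.symm
  simp [hv, length_initialWord] at this

theorem initialWord_periodicWord (l : List B) (hl : 0 < l.length) :
    initialWord (periodicWord l hl) l.length = l := by
  apply List.ext_getElem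
  · simp [length_initialWord]
  · intro n h1 h2
    simp [initialWord, periodicWord, Nat.mod_eq_of_lt h2]

theorem periodicWord_add (l : List B) (hl : 0 < l.length) (n : ℕ) :
    periodicWord l hl (l.length + n) = periodicWord l hl n := by
  simp [periodicWord]

theorem wordProd_periodicWord_add (l : List B) (hl : 0 < l.length) (n : ℕ) :
    wordProd s (initialWord (periodicWord l hl) (l.length + n)) =
      wordProd s l * wordProd s (initialWord (periodicWord l hl) n) := by
  rw [initialWord_add, wordProd_append, initialWord_periodicWord]
  simp only [periodicWord_add]

theorem wordProd_periodicWord_mul (l : List B) (hl : 0 < l.length) (k : ℕ) :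
    wordProd s (initialWord (periodicWord l hl) (k * l.length)) = wordProd s l ^ k := by
  induction k with
  | zero => simp [initialWord, wordProd_nil]
  | succ k ih => rw [Nat.succ_mul, add_comm, wordProd_periodicWord_add, ih, pow_succ']

end WordLemmas

/-! ### Galleries, inversions and reducedness. -/

section Galleries

variable {ι M N : Type*} [Finite ι] [AddCommGroup M] [Module ℝ M] [AddCommGroup N] [Module ℝ N]
  {P : RootPairing ι ℝ M N} [P.IsRootSystem] [P.IsCrystallographic] [P.IsReduced]
  [P.IsIrreducible] (b : P.Base)

theorem affWeyl_inv_apply_self (g : affWeyl P) (x : N) : (g⁻¹).1 (g.1 x) = x :=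
  g.1.symm_apply_apply x

theorem affWeyl_apply_inv_self (g : affWeyl P) (x : N) : g.1 ((g⁻¹).1 x) = x :=
  g.1.apply_symm_apply x

theorem affWeyl_mul_apply (g h : affWeyl P) (x : N) : (g * h).1 x = g.1 (h.1 x) := rfl

/-- The affine roots that are positive on the fundamental alcove and negative on its image
under `g`. -/
def invSet (g : affWeyl P) : Set (N → ℝ) :=
  {f | IsAffRoot P f ∧ 0 < f (basePt b) ∧ f (g.1 (basePt b)) < 0}

/-- The group elements along the gallery of an infinite word. -/
noncomputable def gal (u : ℕ → Option b.support) (r : ℕ) : affWeyl P :=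
  wordProd (simpleRefl b) (initialWord u r)

/-- The affine root whose wall is crossed at step `r` of the gallery of an infinite word. -/
noncomputable def galRoot (u : ℕ → Option b.support) (r : ℕ) : N → ℝ :=
  fun x => sval b (u r) ((gal b u r)⁻¹.1 x)

theorem gal_succ (u : ℕ → Option b.support) (r : ℕ) :
    gal b u (r + 1) = gal b u r * simpleRefl b (u r) := by
  rw [gal, initialWord_succ, wordProd_append, wordProd_singleton, gal]

theorem galRoot_isAffRoot (u : ℕ → Option b.support) (r : ℕ) : IsAffRoot P (galRoot b u r) :=
  (sval_isAffRoot b (u r)).comp _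

/-- Adjacent alcoves are separated by one wall: a root whose sign changes between them becomes,
after composition with g, positive at the base point and flipped by one simple reflection. -/
theorem mem_invSet_mul_simpleRefl {g : affWeyl P} {i : Option b.support} {f : N → ℝ}
    (hf : f ∈ invSet b (g * simpleRefl b i)) :
    f ∈ invSet b g ∨ f = fun x => sval b i (g⁻¹.1 x) := by
  obtain ⟨h1, h2, h3⟩ := hf
  rcases lt_or_gt_of_ne ((h1.comp g).apply_basePt_ne_zero b) with h | h
  · exact Or.inl ⟨h1, h2, h⟩
  · right
    have := (h1.comp g).eq_sval_of_flip b h h3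
    ext x
    rw [← this]
    simp only [affWeyl_apply_inv_self]

theorem invSet_one : invSet b (1 : affWeyl P) = ∅ := by
  exact Set.eq_empty_iff_forall_notMem.2 fun f h => lt_asymm h.2.1 h.2.2

/-- Each letter adds at most one inversion. This bounds the length of every word for an element from
below. -/
theorem encard_invSet_le (l : List (Option b.support)) :
    (invSet b (wordProd (simpleRefl b) l)).encard ≤ l.length := by
  induction l using List.reverseRecOn with
  | nil => rw [wordProd_nil, invSet_one]; simp
  | append_singleton l i ih =>
    rw [wordProd_append, wordProd_singleton]
    refine (Set.encard_le_encard (t := insert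
      (fun x => sval b i ((wordProd (simpleRefl b) l)⁻¹.1 x))
      (invSet b (wordProd (simpleRefl b) l))) fun f hf => ?_).trans ?_
    · exact (mem_invSet_mul_simpleRefl b hf).symm
    · refine (Set.encard_insert_le _ _).trans ?_
      rw [List.length_append]
      push_cast
      gcongr
      simp

theorem exists_eq_galRoot_of_mem_invSet {u : ℕ → Option b.support} {k : ℕ} {f : N → ℝ}
    (hf : f ∈ invSet b (gal b u k)) : ∃ r < k, f = galRoot b u r := by
  induction k with
  | zero =>
    rw [gal, initialWord, List.range_zero, List.map_nil, wordProd_nil, invSet_one] at hf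
    exact absurd hf (Set.notMem_empty f)
  | succ k ih =>
    rw [gal_succ] at hf
    rcases mem_invSet_mul_simpleRefl b hf with h | h
    · obtain ⟨r, hr, h⟩ := ih h
      exact ⟨r, by omega, h⟩
    · exact ⟨k, by omega, h⟩

/-- A wall once crossed is not crossed back: a return at step k would make the k-th wall root the
negative of the r-th one, while both are positive at the base point. -/
theorem galRoot_mem_invSet {u : ℕ → Option b.support} {k : ℕ}
    (h : ∀ r < k, 0 < galRoot b u r (basePt b)) {r : ℕ} (hr : r < k) :
    galRoot b u r ∈ invSet b (gal b u k) := by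
  refine ⟨galRoot_isAffRoot b u r, h r hr, ?_⟩
  induction k with
  | zero => omega
  | succ k ih =>
    have hself : galRoot b u k ((gal b u (k + 1)).1 (basePt b)) < 0 := by
      rw [gal_succ, affWeyl_mul_apply, galRoot, affWeyl_inv_apply_self, sval_simpleRefl]
      linarith [sval_basePt_pos b (u k)]
    rcases Nat.lt_succ_iff_lt_or_eq.1 hr with hr' | rfl
    · have h1 := ih (fun q hq => h q (by omega)) hr'
      rcases lt_or_gt_of_ne
        (((galRoot_isAffRoot b u r).comp (gal b u (k + 1))).apply_basePt_ne_zero b) with h2 | h2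
      · exact h2
      · exfalso
        have hneg := (galRoot_isAffRoot b u r).neg
        have h3 := (hneg.comp (gal b u k)).eq_sval_of_flip b (i := u k) (by simpa using h1)
          (by rw [gal_succ] at h2; simpa using h2)
        have h4 : galRoot b u k (basePt b) = -galRoot b u r (basePt b) := by
          rw [galRoot, ← h3]
          simp only [affWeyl_apply_inv_self]
        have := h r hr
        have := h k (by omega)
        linarith
    · exact hself

theorem galRoot_ne_of_lt {u : ℕ → Option b.support} {q r : ℕ} (hqr : q < r)
    (h : ∀ k < r, 0 < galRoot b u k (basePt b)) : galRoot b u q ≠ galRoot b u r := by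
  intro heq
  have h1 := (galRoot_mem_invSet b h hqr).2.2
  rw [heq, galRoot, affWeyl_inv_apply_self] at h1
  exact lt_asymm h1 (sval_basePt_pos b _)

/-- The k wall roots are distinct inversions of the endpoint, so no word with fewer than k letters
reaches it. -/
theorem isReducedWord_of_galRoot_pos {u : ℕ → Option b.support} {k : ℕ}
    (h : ∀ r < k, 0 < galRoot b u r (basePt b)) :
    IsReducedWord (simpleRefl b) (initialWord u k) := by
  intro l hl
  have hinj : Set.InjOn (galRoot b u) (Set.Iio k) := by
    intro q hq r hr heq
    by_contra hne
    rcases lt_or_gt_of_ne hne with h1 | h1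
    · exact galRoot_ne_of_lt b h1 (fun m hm => h m (hm.trans hr)) heq
    · exact galRoot_ne_of_lt b h1 (fun m hm => h m (hm.trans hq)) heq.symm
  have h1 : (galRoot b u '' Set.Iio k).encard ≤ l.length := by
    refine le_trans (Set.encard_le_encard ?_) (encard_invSet_le b l)
    rintro _ ⟨r, hr, rfl⟩
    rw [hl]
    exact galRoot_mem_invSet b h hr
  rw [hinj.encard_image, ← Finset.coe_range, Set.encard_coe_eq_coe_finsetCard,
    Finset.card_range] at h1
  rw [length_initialWord]
  exact_mod_cast h1

theorem affRefl_apply' (j : ι) (k : ℤ) (x : N) :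
    affRefl P j k x = x - affVal P j k x • P.coroot j := affRefl_apply P j k x

theorem affVal_injective {j j' : ι} {k k' : ℤ} (h : affVal P j k = affVal P j' k') :
    j = j' ∧ k = k' := by
  have h0 := congrFun h 0
  rw [affVal_zero, affVal_zero, neg_inj] at h0
  refine ⟨P.root.injective (P.toPerfPair.injective ?_), by exact_mod_cast h0⟩
  ext v
  have h1 := congrFun h v
  simp only [affVal, h0] at h1
  simpa using h1

/-- The reflection attached to the image of a simple affine root. -/
theorem exists_conj_simpleRefl_eq (g : affWeyl P) (i : Option b.support) : ∃ j k,
    (fun x => sval b i (g⁻¹.1 x)) = affVal P j k ∧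
      (g * simpleRefl b i * g⁻¹).1 = affRefl P j k := by
  obtain ⟨j0, k0, h1, h2, -, -⟩ := exists_affVal_eq_sval b i
  obtain ⟨j, k, h3, h4⟩ := exists_affVal_comp g⁻¹.2 j0 k0
  have h5 : (fun x => sval b i (g⁻¹.1 x)) = affVal P j k := by
    ext x
    rw [h1, h3]
  refine ⟨j, k, h5, ?_⟩
  ext x
  rw [affRefl_apply', ← h5]
  change g.1 ((simpleRefl b i).1 (g⁻¹.1 x)) = _
  rw [simpleRefl_apply, sub_eq_add_neg, affineEquiv_apply_add, affWeyl_apply_inv_self, map_neg,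
    map_smul, h2, ← h4]
  have : g.1.linear (g⁻¹.1.linear (P.coroot j)) = P.coroot j :=
    g.1.linear.apply_symm_apply _
  rw [this]
  module

/-- Positivity at the base point fixes the sign, the only ambiguity in recovering an affine root
from its reflection. This moves inversion sets between reflections and functions. -/
theorem affVal_eq_of_affRefl_eq {j j' : ι} {k k' : ℤ} (h : affRefl P j k = affRefl P j' k')
    (h1 : 0 < affVal P j k (basePt b)) (h2 : 0 < affVal P j' k' (basePt b)) :
    affVal P j k = affVal P j' k' := by
  have h3 : ∀ x, affVal P j k x • P.coroot j = affVal P j' k' x • P.coroot j' := fun x => by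
    have := congrArg (fun f => f x) h
    simp only [affRefl_apply'] at this
    exact sub_right_injective this
  set c := affVal P j' k' (basePt b) / affVal P j k (basePt b) with hc
  have hc0 : 0 < c := div_pos h2 h1
  have h4 : P.coroot j = c • P.coroot j' := by
    rw [hc, div_eq_inv_mul, mul_smul, ← h3, smul_smul, inv_mul_cancel₀ h1.ne', one_smul]
  refine (affVal_eq_of_eq_mul (c := c) hc0.le fun x => ?_).symm
  have h5 := h3 x
  rw [h4, smul_smul] at h5
  have := smul_left_injective ℝ (P.ne_zero' j') h5
  linarith

theorem affRefl_eq_of_affVal_neg {j j' : ι} {k k' : ℤ}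
    (h : ∀ x, affVal P j' k' x = -affVal P j k x) : affRefl P j' k' = affRefl P j k := by
  have h1 : affVal P (P.reflectionPerm j j) (-k) = affVal P j' k' := by
    ext x
    rw [h]
    simp [affVal]
    ring
  obtain ⟨rfl, rfl⟩ := affVal_injective h1
  ext x
  rw [affRefl_apply', affRefl_apply', h]
  simp

/-- If the r-th root were negative, its opposite would already be an inversion, crossed at some q <
r. The same reflection would then occur twice, against reducedness. -/
theorem galRoot_pos_of_isReducedWord {u : ℕ → Option b.support} {r : ℕ}
    (h : IsReducedWord (simpleRefl b) (initialWord u (r + 1))) :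
    0 < galRoot b u r (basePt b) := by
  rcases lt_or_gt_of_ne ((galRoot_isAffRoot b u r).apply_basePt_ne_zero b) with h1 | h1
  swap
  · exact h1
  exfalso
  have hmem : (fun x => -galRoot b u r x) ∈ invSet b (gal b u r) := by
    refine ⟨(galRoot_isAffRoot b u r).neg, by linarith, ?_⟩
    simp only [galRoot, affWeyl_inv_apply_self]
    linarith [sval_basePt_pos b (u r)]
  obtain ⟨q, hq, heq⟩ := exists_eq_galRoot_of_mem_invSet b hmem
  obtain ⟨j, k, h2, h3⟩ := exists_conj_simpleRefl_eq b (gal b u r) (u r)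
  obtain ⟨j', k', h4, h5⟩ := exists_conj_simpleRefl_eq b (gal b u q) (u q)
  refine not_isReducedWord_of_conj_eq (simpleRefl_mul_self b) hq (Subtype.ext ?_) h
  change (gal b u q * simpleRefl b (u q) * (gal b u q)⁻¹).1 =
    (gal b u r * simpleRefl b (u r) * (gal b u r)⁻¹).1
  rw [h3, h5]
  refine affRefl_eq_of_affVal_neg fun x => ?_
  rw [← h2, ← h4]
  exact (congrFun heq x).symm

/-- The reflections in simple affine roots generate the affine Weyl group. -/
theorem exists_wordProd_eq (g : affWeyl P) : ∃ l, wordProd (simpleRefl b) l = g := by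
  let H : Subgroup (affWeyl P) := Subgroup.closure (Set.range (simpleRefl b))
  -- Induction on the value at the base point, measured in units of `(coxNum b)⁻¹`, the common value
  -- of the simple affine roots there. Reflecting in a simple root that pairs positively lowers the
  -- value by at least one unit.
  have hmem : ∀ n : ℕ, ∀ j k, 0 < affVal P j k (basePt b) →
      affVal P j k (basePt b) ≤ n * (coxNum b)⁻¹ →
      ∃ t ∈ H, t.1 = affRefl P j k := by
    intro n
    induction n with
    | zero => intro j k h1 h2; simp at h2; linarith
    | succ n ih =>
      intro j k h1 h2
      have hf : IsAffRoot P (affVal P j k) := ⟨j, k, rfl⟩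
      obtain ⟨c, hc, hc0⟩ := hf.exists_nonneg b h1.le
      -- ⟨α, α^∨⟩ = 2 is a nonnegative combination of the pairings of simple affine roots with α^∨,
      -- so one of them is positive.
      have hex : ∃ i, 0 < P.toLinearMap (aroot b i) (P.coroot j) := by
        by_contra! hneg
        have h3 : ∀ v, P.toLinearMap (P.root j) v =
            ∑ i, c i * P.toLinearMap (aroot b i) v := by
          intro v
          have h4 := affVal_add (P := P) j k 0 v
          rw [hc, hc] at h4
          simp only [sval_add, mul_add, Finset.sum_add_distrib] at h4
          linarith
        have h4 := h3 (P.coroot j)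
        rw [P.root_coroot_eq_pairing, P.pairing_same] at h4
        have : ∑ i, c i * P.toLinearMap (aroot b i) (P.coroot j) ≤ 0 :=
          Finset.sum_nonpos fun i _ => mul_nonpos_of_nonneg_of_nonpos (hc0 i) (hneg i)
        linarith
      obtain ⟨i, hi⟩ := hex
      obtain ⟨j0, k0, e1, e2, e3, e4⟩ := exists_affVal_eq_sval b i
      by_cases heq : affVal P j k = sval b i
      · refine ⟨simpleRefl b i, Subgroup.subset_closure ⟨i, rfl⟩, ?_⟩
        rw [e1] at heq
        obtain ⟨rfl, rfl⟩ := affVal_injective heq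
        exact e4
      obtain ⟨j', k', h5, h6⟩ := exists_affVal_comp (simpleRefl b i).2 j k
      have hpos : 0 < affVal P j' k' (basePt b) := by
        rw [← h5]
        rcases lt_or_gt_of_ne ((hf.comp (simpleRefl b i)).apply_basePt_ne_zero b) with h | h
        · exact absurd (hf.eq_sval_of_flip b h1 h) heq
        · exact h
      have hpair : 1 ≤ P.pairing j j0 := by
        have h7 : 0 < P.pairingIn ℤ j0 j := by
          rw [e3, P.root_coroot_eq_pairing, ← P.algebraMap_pairingIn ℤ] at hi
          simpa using hi
        rw [P.zero_lt_pairingIn_iff' ℤ] at h7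
        rw [← P.algebraMap_pairingIn ℤ]
        have : 1 ≤ P.pairingIn ℤ j j0 := h7
        simpa using (Int.cast_le (R := ℝ)).2 this
      obtain ⟨t, ht, ht'⟩ := ih j' k' hpos <| by
        rw [← h5, simpleRefl_apply, sub_eq_add_neg, affVal_add, map_neg, map_smul, sval_basePt, e2,
          P.root_coroot_eq_pairing, smul_eq_mul]
        have := inv_pos.2 (coxNum_pos b)
        push_cast at h2
        nlinarith
      refine ⟨simpleRefl b i * t * simpleRefl b i, H.mul_mem (H.mul_mem
        (Subgroup.subset_closure ⟨i, rfl⟩) ht) (Subgroup.subset_closure ⟨i, rfl⟩), ?_⟩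
      ext x
      change (simpleRefl b i).1 (t.1 ((simpleRefl b i).1 x)) = _
      have hinv : (simpleRefl b i).1 ((simpleRefl b i).1 x) = x := by
        rw [← affWeyl_mul_apply, simpleRefl_mul_self]; rfl
      rw [ht', affRefl_apply', sub_eq_add_neg, affineEquiv_apply_add, hinv, map_neg, map_smul, h6,
        ← h5, hinv, affRefl_apply', sub_eq_add_neg]
  have hH : g ∈ H := by
    have hall : ∀ j k, ∃ t ∈ H, t.1 = affRefl P j k := by
      intro j k
      have key : ∀ j k, 0 < affVal P j k (basePt b) → ∃ t ∈ H, t.1 = affRefl P j k := by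
        intro j k h
        obtain ⟨n, hn⟩ := exists_nat_ge (affVal P j k (basePt b) * coxNum b)
        refine hmem n j k h ?_
        rwa [← div_eq_mul_inv, le_div_iff₀ (coxNum_pos b)]
      rcases lt_or_gt_of_ne (IsAffRoot.apply_basePt_ne_zero b ⟨j, k, rfl⟩) with h | h
      · have hneg : ∀ x, affVal P (P.reflectionPerm j j) (-k) x = -affVal P j k x := fun x => by
          simp [affVal]; ring
        rw [← affRefl_eq_of_affVal_neg hneg]
        refine key _ _ ?_
        rw [hneg]
        linarith
      · exact key j k h
    have hle : affWeyl P ≤ H.map (affWeyl P).subtype := by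
      refine (Subgroup.closure_le _).2 ?_
      rintro _ ⟨⟨j, k⟩, rfl⟩
      obtain ⟨t, ht, h⟩ := hall j k
      exact ⟨t, ht, h⟩
    obtain ⟨t, ht, h⟩ := hle g.2
    rwa [← Subtype.ext (h : t.1 = g.1)]
  clear hmem
  induction hH using Subgroup.closure_induction'' with
  | mem x hx =>
    obtain ⟨i, rfl⟩ := hx
    exact ⟨[i], wordProd_singleton _ i⟩
  | inv_mem x hx =>
    obtain ⟨i, rfl⟩ := hx
    exact ⟨[i], by rw [wordProd_singleton, simpleRefl_inv]⟩
  | one => exact ⟨[], rfl⟩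
  | mul x y _ _ hx hy =>
    obtain ⟨l, rfl⟩ := hx
    obtain ⟨l', rfl⟩ := hy
    exact ⟨l ++ l', wordProd_append _ l l'⟩

end Galleries

/-! ### Inversion sets of limit elements, rays and minimality. -/

section LimitElements

variable {ι M N : Type*} [Finite ι] [AddCommGroup M] [Module ℝ M] [AddCommGroup N] [Module ℝ N]
  {P : RootPairing ι ℝ M N} [P.IsRootSystem] [P.IsCrystallographic] [P.IsReduced]
  [P.IsIrreducible] (b : P.Base)

/-- The reflections in the walls of a set of affine roots. -/
def reflSet (S : Set (N → ℝ)) : Set (affWeyl P) :=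
  {t | ∃ j k, affVal P j k ∈ S ∧ t.1 = affRefl P j k}

/-- The affine roots that are positive on the fundamental alcove and decrease along `v`. -/
def rayRoots (v : N) : Set (N → ℝ) :=
  {f | ∃ j k, f = affVal P j k ∧ 0 < f (basePt b) ∧ P.toLinearMap (P.root j) v < 0}

/-- The affine transformation `g` is the translation by `v`. -/
def IsTransl (g : affWeyl P) (v : N) : Prop := ∀ x, g.1 x = x + v

theorem affVal_mem_rayRoots {j : ι} {k : ℤ} {v : N} : affVal P j k ∈ rayRoots b v ↔
    0 < affVal P j k (basePt b) ∧ P.toLinearMap (P.root j) v < 0 := by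
  constructor
  · rintro ⟨j', k', h, h1, h2⟩
    obtain ⟨rfl, rfl⟩ := affVal_injective h
    exact ⟨h1, h2⟩
  · rintro ⟨h1, h2⟩
    exact ⟨j, k, rfl, h1, h2⟩

theorem infInv_eq_reflSet (u : ℕ → Option b.support) :
    infInv (simpleRefl b) u = reflSet (Set.range (galRoot b u)) := by
  ext t
  constructor
  · rintro ⟨r, rfl⟩
    obtain ⟨j, k, h1, h2⟩ := exists_conj_simpleRefl_eq b (gal b u r) (u r)
    exact ⟨j, k, ⟨r, h1⟩, h2⟩
  · rintro ⟨j, k, ⟨r, hr⟩, ht⟩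
    obtain ⟨j', k', h1, h2⟩ := exists_conj_simpleRefl_eq b (gal b u r) (u r)
    obtain ⟨rfl, rfl⟩ := affVal_injective (hr.symm.trans h1)
    exact ⟨r, Subtype.ext (h2.trans ht.symm)⟩

theorem affRefl_mem_affWeyl (j : ι) (k : ℤ) : affRefl P j k ∈ affWeyl P :=
  Subgroup.subset_closure ⟨(j, k), rfl⟩

theorem subset_of_reflSet_subset {S S' : Set (N → ℝ)}
    (hS : ∀ f ∈ S, IsAffRoot P f ∧ 0 < f (basePt b)) (hS' : ∀ f ∈ S', 0 < f (basePt b))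
    (h : (reflSet S : Set (affWeyl P)) ⊆ reflSet S') : S ⊆ S' := by
  intro f hf
  obtain ⟨⟨j, k, rfl⟩, hpos⟩ := hS f hf
  obtain ⟨j', k', h1, h2⟩ := h (a := ⟨affRefl P j k, affRefl_mem_affWeyl j k⟩) ⟨j, k, hf, rfl⟩
  rwa [affVal_eq_of_affRefl_eq b h2 hpos (hS' _ h1)]

theorem isAffRoot_and_pos_of_mem_rayRoots {v : N} :
    ∀ f ∈ rayRoots b v, IsAffRoot P f ∧ 0 < f (basePt b) := by
  rintro f ⟨j, k, h, h1, -⟩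
  exact ⟨⟨j, k, h⟩, h1⟩

/-- Every finite root is the linear part of an affine root positive at the base point, obtained by
taking k small. So `rayRoots` remembers exactly the set of roots negative on v. -/
theorem reflSet_rayRoots_subset_iff {v w : N} :
    (reflSet (rayRoots b v) : Set (affWeyl P)) ⊆ reflSet (rayRoots b w) ↔
      ∀ j, P.toLinearMap (P.root j) v < 0 → P.toLinearMap (P.root j) w < 0 := by
  constructor
  · intro h j hj
    have h1 := subset_of_reflSet_subset b (isAffRoot_and_pos_of_mem_rayRoots b)
      (fun f hf => (isAffRoot_and_pos_of_mem_rayRoots b f hf).2) h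
    obtain ⟨k, hk⟩ := exists_int_lt (P.toLinearMap (P.root j) (basePt b))
    have h2 := h1 ((affVal_mem_rayRoots b (j := j) (k := k)).2 ⟨sub_pos.2 hk, hj⟩)
    exact ((affVal_mem_rayRoots b).1 h2).2
  · rintro h t ⟨j, k, h1, h2⟩
    rw [affVal_mem_rayRoots] at h1
    exact ⟨j, k, (affVal_mem_rayRoots b).2 ⟨h1.1, h j h1.2⟩, h2⟩

theorem IsTransl.pow {g : affWeyl P} {v : N} (h : IsTransl g v) (k : ℕ) :
    IsTransl (g ^ k) ((k : ℝ) • v) := by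
  induction k with
  | zero => intro x; simp
  | succ k ih =>
    intro x
    rw [pow_succ', affWeyl_mul_apply, ih, h]
    push_cast
    module

theorem IsTransl.linear_apply {g : affWeyl P} {v : N} (h : IsTransl g v) (w : N) :
    g.1.linear w = w := by
  have := affineEquiv_apply_add g.1 0 w
  rw [h, h, zero_add, zero_add, add_comm] at this
  exact (add_left_cancel this).symm

theorem galRoot_pos_of_isInfReducedWord {u : ℕ → Option b.support}
    (h : IsInfReducedWord (simpleRefl b) u) (r : ℕ) : 0 < galRoot b u r (basePt b) :=
  galRoot_pos_of_isReducedWord b (h (r + 1))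

theorem galRoot_injective {u : ℕ → Option b.support}
    (h : IsInfReducedWord (simpleRefl b) u) : Function.Injective (galRoot b u) := by
  intro q r heq
  by_contra hne
  rcases lt_or_gt_of_ne hne with h1 | h1
  · exact galRoot_ne_of_lt b h1 (fun m _ => galRoot_pos_of_isInfReducedWord b h m) heq
  · exact galRoot_ne_of_lt b h1 (fun m _ => galRoot_pos_of_isInfReducedWord b h m) heq.symm

/-- The inversions of the limit of the powers of `g` are the affine roots decreasing along the
translation part of a power of `g`. -/
theorem range_galRoot_periodicWord {l : List (Option b.support)} {hl : 0 < l.length}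
    (h : IsInfReducedWord (simpleRefl b) (periodicWord l hl)) {m : ℕ} {v : N} (hm : 0 < m)
    (hv : IsTransl (wordProd (simpleRefl b) l ^ m) v) :
    Set.range (galRoot b (periodicWord l hl)) = rayRoots b v := by
  have hpos := galRoot_pos_of_isInfReducedWord b h
  have hgal : ∀ k : ℕ, IsTransl (gal b (periodicWord l hl) (m * k * l.length)) ((k : ℝ) • v) := by
    intro k
    rw [gal, wordProd_periodicWord_mul, pow_mul]
    exact hv.pow k
  ext f
  constructor
  · rintro ⟨r, rfl⟩
    obtain ⟨j, k, hjk⟩ := galRoot_isAffRoot b (periodicWord l hl) r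
    refine ⟨j, k, hjk, hpos r, ?_⟩
    -- After m(r + 1) periods the gallery has passed step r and stands at the base point translated
    -- by (r + 1)v; there the root is negative.
    have hlt : r < m * (r + 1) * l.length := by nlinarith [Nat.mul_pos hm hl]
    have h2 := (galRoot_mem_invSet b (fun q _ => hpos q) hlt).2.2
    have h3 := hpos r
    rw [hgal (r + 1), hjk, affVal_add, map_smul, smul_eq_mul] at h2
    rw [hjk] at h3
    by_contra hneg
    have : (0 : ℝ) ≤ ((r + 1 : ℕ) : ℝ) * P.toLinearMap (P.root j) v :=
      mul_nonneg (Nat.cast_nonneg _) (not_lt.1 hneg)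
    linarith
  · rintro ⟨j, k, rfl, h1, h2⟩
    obtain ⟨n, hn⟩ := exists_nat_gt (affVal P j k (basePt b) / -P.toLinearMap (P.root j) v)
    rw [div_lt_iff₀ (by linarith)] at hn
    have hmem : affVal P j k ∈ invSet b (gal b (periodicWord l hl) (m * n * l.length)) := by
      refine ⟨⟨j, k, rfl⟩, h1, ?_⟩
      rw [hgal, affVal_add, map_smul, smul_eq_mul]
      linarith
    obtain ⟨r, -, hr⟩ := exists_eq_galRoot_of_mem_invSet b hmem
    exact ⟨r, hr.symm⟩

theorem IsInfPower.inv_eq {g : affWeyl P} {x : LimitElement (simpleRefl b)}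
    (hx : IsInfPower (simpleRefl b) g x) {m : ℕ} {v : N} (hm : 0 < m) (hv : IsTransl (g ^ m) v) :
    x.inv = reflSet (rayRoots b v) := by
  obtain ⟨l, hl, h, rfl, -, rfl⟩ := hx
  rw [← range_galRoot_periodicWord b h hm hv, ← infInv_eq_reflSet]
  rfl

/-- The variation of the `r`-th root of a gallery along a vector. -/
noncomputable def galDir (u : ℕ → Option b.support) (r : ℕ) (v : N) : ℝ :=
  P.toLinearMap (aroot b (u r)) ((gal b u r)⁻¹.1.linear v)

theorem galRoot_add (u : ℕ → Option b.support) (r : ℕ) (x v : N) :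
    galRoot b u r (x + v) = galRoot b u r x + galDir b u r v := by
  rw [galRoot, affineEquiv_apply_add, sval_add, galRoot, galDir]

/-- If all roots along a gallery decrease in a common direction, the gallery is reduced. -/
theorem isInfReducedWord_of_galDir_neg {u : ℕ → Option b.support} {v : N}
    (h : ∀ r, galDir b u r v < 0) : IsInfReducedWord (simpleRefl b) u := by
  intro k
  refine isReducedWord_of_galRoot_pos b fun r _ => ?_
  rcases lt_or_gt_of_ne ((galRoot_isAffRoot b u r).apply_basePt_ne_zero b) with h1 | h1
  swap
  · exact h1
  exfalso
  have hmem : (fun x => -galRoot b u r x) ∈ invSet b (gal b u r) := by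
    refine ⟨(galRoot_isAffRoot b u r).neg, by linarith, ?_⟩
    simp only [galRoot, affWeyl_inv_apply_self]
    linarith [sval_basePt_pos b (u r)]
  obtain ⟨q, -, heq⟩ := exists_eq_galRoot_of_mem_invSet b hmem
  -- Comparing values at 0 and at v: the opposite of the r-th root increases along v, whereas the
  -- q-th root, to which it is equal, decreases.
  have h2 := congrFun heq 0
  have h3 := congrFun heq (0 + v)
  simp only [galRoot_add] at h2 h3
  have := h q
  have := h r
  linarith

/-- Since the linear part of one period fixes v, the variations of the wall roots along v are
periodic, and one period suffices. -/
theorem isInfReducedWord_periodicWord {l : List (Option b.support)} {hl : 0 < l.length} {v : N}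
    (hfix : (wordProd (simpleRefl b) l).1.linear v = v)
    (h : ∀ r < l.length, galDir b (periodicWord l hl) r v < 0) :
    IsInfReducedWord (simpleRefl b) (periodicWord l hl) := by
  refine isInfReducedWord_of_galDir_neg b (v := v) fun r => ?_
  induction r using Nat.strong_induction_on with
  | _ r ih =>
    by_cases hr : r < l.length
    · exact h r hr
    · obtain ⟨n, rfl⟩ := Nat.exists_eq_add_of_le (not_lt.1 hr)
      have h1 := ih n (by omega)
      have hfix' : (wordProd (simpleRefl b) l)⁻¹.1.linear v = v := by
        conv_lhs => rw [← hfix]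
        exact (wordProd (simpleRefl b) l).1.linear.symm_apply_apply v
      have : galDir b (periodicWord l hl) (l.length + n) v = galDir b (periodicWord l hl) n v := by
        simp only [galDir, periodicWord_add, gal, wordProd_periodicWord_add, mul_inv_rev]
        congr 1
        change (wordProd (simpleRefl b) (initialWord (periodicWord l hl) n))⁻¹.1.linear
          ((wordProd (simpleRefl b) l)⁻¹.1.linear v) = _
        rw [hfix']
      rw [this]
      exact h1

theorem exists_isInfPower {l : List (Option b.support)} {hl : 0 < l.length}
    (h : IsInfReducedWord (simpleRefl b) (periodicWord l hl)) :
    ∃ x, IsInfPower (simpleRefl b) (wordProd (simpleRefl b) l) x :=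
  ⟨limitMk _ _ h, l, hl, h, rfl, by
    simpa only [initialWord_periodicWord] using h l.length, rfl⟩

/-- Along a reduced word of t every wall separates the base point from its translate by v, so its
root decreases along v. Repeating the word therefore keeps it reduced. -/
theorem IsTransl.exists_isInfPower {t : affWeyl P} {v : N} (ht : IsTransl t v) (hv : v ≠ 0) :
    ∃ x, IsInfPower (simpleRefl b) t x := by
  obtain ⟨l0, hl0⟩ := exists_wordProd_eq b t
  obtain ⟨l, hl, hred⟩ := exists_isReducedWord (simpleRefl b) l0
  rw [hl0] at hl
  subst hl
  have hlen : 0 < l.length := by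
    rw [List.length_pos_iff]
    rintro rfl
    have := ht 0
    rw [wordProd_nil] at this
    exact hv (by simpa using this.symm)
  refine LimitWeak.exists_isInfPower b (hl := hlen) (isInfReducedWord_periodicWord b (v := v)
    (ht.linear_apply v) fun r hr => ?_)
  have hpos : ∀ q < l.length, 0 < galRoot b (periodicWord l hlen) q (basePt b) := by
    intro q hq
    refine galRoot_pos_of_isReducedWord b ?_
    obtain ⟨n, hn⟩ := Nat.exists_eq_add_of_lt hq
    rw [← initialWord_periodicWord l hlen, hn, show q + n + 1 = (q + 1) + n by ring,
      initialWord_add] at hred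
    exact hred.of_append
  have h1 := (galRoot_mem_invSet b hpos hr).2.2
  have h2 := hpos r hr
  rw [gal, initialWord_periodicWord, ht, galRoot_add] at h1
  linarith

/-- The limit element of a ray orthogonal to sufficiently many roots is minimal. -/
theorem isMin_of_inv_eq_rayRoots {x : LimitElement (simpleRefl b)} {v : N}
    (hx : x.inv = reflSet (rayRoots b v))
    (hspan : ∀ w, (∀ j, P.toLinearMap (P.root j) v = 0 → P.toLinearMap (P.root j) w = 0) →
      ∃ r : ℝ, w = r • v) : IsMin x := by
  intro y hy
  induction y using Quotient.inductionOn with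
  | _ u =>
  obtain ⟨u, hu⟩ := u
  have hyinv : LimitElement.inv (simpleRefl b) (Quotient.mk (limitSetoid (simpleRefl b)) ⟨u, hu⟩) =
      reflSet (Set.range (galRoot b u)) := infInv_eq_reflSet b u
  change LimitElement.inv _ _ ⊆ LimitElement.inv _ _ at hy
  change LimitElement.inv _ _ ⊆ LimitElement.inv _ _
  rw [hyinv, hx] at hy ⊢
  have hpos := galRoot_pos_of_isInfReducedWord b hu
  have hsub : Set.range (galRoot b u) ⊆ rayRoots b v := by
    refine subset_of_reflSet_subset b ?_
      (fun f hf => (isAffRoot_and_pos_of_mem_rayRoots b f hf).2) hy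
    rintro _ ⟨r, rfl⟩
    exact ⟨galRoot_isAffRoot b u r, hpos r⟩
  suffices rayRoots b v ⊆ Set.range (galRoot b u) by
    rintro t ⟨j, k, h1, h2⟩
    exact ⟨j, k, this h1, h2⟩
  by_contra hcon
  rw [Set.not_subset] at hcon
  obtain ⟨_, ⟨j0, k0, rfl, hf1, hf2⟩, hfn⟩ := hcon
  set p : ℕ → N := fun n => (gal b u n).1 (basePt b) with hp
  -- A positive affine root that is never crossed stays nonnegative on the whole gallery, so its
  -- linear part is bounded below there.
  have hlow : ∀ j k, 0 < affVal P j k (basePt b) → affVal P j k ∉ Set.range (galRoot b u) →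
      ∀ n, (k : ℝ) ≤ P.toLinearMap (P.root j) (p n) := by
    intro j k h1 h2 n
    by_contra hlt
    have hmem : affVal P j k ∈ invSet b (gal b u n) :=
      ⟨⟨j, k, rfl⟩, h1, by simpa [affVal] using hlt⟩
    obtain ⟨r, -, hr⟩ := exists_eq_galRoot_of_mem_invSet b hmem
    exact h2 ⟨r, hr.symm⟩
  have hlow' : ∀ j, 0 ≤ P.toLinearMap (P.root j) v →
      ∃ k : ℤ, ∀ n, (k : ℝ) ≤ P.toLinearMap (P.root j) (p n) := by
    intro j hj
    obtain ⟨k, hk⟩ := exists_int_lt (P.toLinearMap (P.root j) (basePt b))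
    refine ⟨k, hlow j k (sub_pos.2 hk) fun hmem => ?_⟩
    exact absurd ((affVal_mem_rayRoots b).1 (hsub hmem)).2 (not_lt.2 hj)
  have hup : ∀ j, P.toLinearMap (P.root j) v ≤ 0 →
      ∃ k : ℝ, ∀ n, P.toLinearMap (P.root j) (p n) ≤ k := by
    intro j hj
    obtain ⟨k, hk⟩ := hlow' (P.reflectionPerm j j) (by simpa using hj)
    refine ⟨-k, fun n => ?_⟩
    have := hk n
    simp only [P.root_reflectionPerm, P.reflection_apply_self, map_neg,
      LinearMap.neg_apply] at this
    linarith
  -- The linear functionals bounded on the gallery. It contains every root orthogonal to v, and also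
  -- the root of the missing inversion, bounded below because it is not crossed and above because
  -- its opposite is not crossed downwards far enough.
  let Bd : Submodule ℝ M :=
    { carrier := {m | ∃ C : ℝ, ∀ n, |P.toLinearMap m (p n)| ≤ C}
      add_mem' := by
        rintro m m' ⟨C, hC⟩ ⟨C', hC'⟩
        refine ⟨C + C', fun n => ?_⟩
        rw [map_add, LinearMap.add_apply]
        exact (abs_add_le _ _).trans (add_le_add (hC n) (hC' n))
      zero_mem' := ⟨0, fun n => by simp⟩
      smul_mem' := by
        rintro r m ⟨C, hC⟩
        refine ⟨|r| * C, fun n => ?_⟩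
        rw [map_smul, LinearMap.smul_apply, smul_eq_mul, abs_mul]
        exact mul_le_mul_of_nonneg_left (hC n) (abs_nonneg r) }
  have hmemBd : ∀ j (k k' : ℝ), (∀ n, k ≤ P.toLinearMap (P.root j) (p n)) →
      (∀ n, P.toLinearMap (P.root j) (p n) ≤ k') → P.root j ∈ Bd := by
    intro j k k' h1 h2
    exact ⟨max |k| |k'|, fun n => abs_le_max_abs_abs (h1 n) (h2 n)⟩
  -- A coweight annihilating `Bd` is a multiple of v by `hspan`, and it is zero because the root
  -- `j0`, which is negative on v, also annihilates it.
  have hBd : Bd = ⊤ := by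
    by_contra hne
    obtain ⟨φ, hφ, hle⟩ := Submodule.exists_le_ker_of_lt_top Bd (lt_top_iff_ne_top.2 hne)
    set w := P.toLinearMap.flip.toPerfPair.symm φ with hw
    have hφw : ∀ m, φ m = P.toLinearMap m w := fun m => by
      rw [hw, LinearMap.apply_toPerfPair_flip]
    obtain ⟨r, hr⟩ := hspan w fun j hj => by
      rw [← hφw]
      obtain ⟨k, hk⟩ := hlow' j hj.ge
      obtain ⟨k', hk'⟩ := hup j hj.le
      exact hle (hmemBd j k k' hk hk')
    have h0 : φ (P.root j0) = 0 := by
      obtain ⟨k', hk'⟩ := hup j0 hf2.le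
      exact hle (hmemBd j0 k0 k' (hlow j0 k0 hf1 hfn) hk')
    rw [hφw, hr, map_smul, smul_eq_mul] at h0
    rcases mul_eq_zero.1 h0 with h | h
    · refine hφ (LinearMap.ext fun m => ?_)
      rw [hφw, hr, h]
      simp
    · exact absurd h hf2.ne
  have hbound : ∀ j, ∃ C : ℝ, ∀ n, |P.toLinearMap (P.root j) (p n)| ≤ C := fun j => by
    have : P.root j ∈ Bd := by rw [hBd]; trivial
    exact this
  choose C hC using hbound
  -- A bounded gallery meets only finitely many walls, but an infinite reduced word crosses
  -- infinitely many distinct ones.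
  refine Set.infinite_range_of_injective (galRoot_injective b hu) (Set.Finite.subset
    (Set.finite_iUnion fun j => (Set.finite_Icc ⌊-C j⌋
      ⌈P.toLinearMap (P.root j) (basePt b)⌉).image (affVal P j)) ?_)
  rintro _ ⟨r, rfl⟩
  obtain ⟨j, k, hjk⟩ := galRoot_isAffRoot b u r
  have h1 := hpos r
  have h2 := (galRoot_mem_invSet b (fun q _ => hpos q) (Nat.lt_succ_self r)).2.2
  rw [hjk] at h1 h2 ⊢
  refine Set.mem_iUnion.2 ⟨j, k, ⟨?_, ?_⟩, rfl⟩
  · have h3 := (abs_le.1 (hC j (r + 1))).1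
    have h4 : (⌊-C j⌋ : ℝ) ≤ -C j := Int.floor_le _
    have h5 : P.toLinearMap (P.root j) (p (r + 1)) - k < 0 := h2
    have : (⌊-C j⌋ : ℝ) ≤ k := by linarith
    exact_mod_cast this
  · have h4 := Int.le_ceil (P.toLinearMap (P.root j) (basePt b))
    have h5 : 0 < P.toLinearMap (P.root j) (basePt b) - k := h1
    have : (k : ℝ) ≤ ⌈P.toLinearMap (P.root j) (basePt b)⌉ := by linarith
    exact_mod_cast this

end LimitElements

/-! ### The finite Weyl group and dominant coweights. -/

section FiniteWeyl

variable {ι M N : Type*} [Finite ι] [AddCommGroup M] [Module ℝ M] [AddCommGroup N] [Module ℝ N]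
  {P : RootPairing ι ℝ M N}

theorem exists_coroot_eq_of_mem_finWeyl {w : N ≃ₗ[ℝ] N} (hw : w ∈ finWeyl P) : ∀ j, ∃ j',
    w (P.coroot j) = P.coroot j' ∧
      ∀ x, P.toLinearMap (P.root j') (w x) = P.toLinearMap (P.root j) x := by
  have key : ∀ i j, ∃ j', P.coreflection i (P.coroot j) = P.coroot j' ∧
      ∀ x, P.toLinearMap (P.root j') (P.coreflection i x) = P.toLinearMap (P.root j) x := by
    intro i j
    refine ⟨P.reflectionPerm i j, (P.coroot_reflectionPerm i j).symm, fun x => ?_⟩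
    simp only [P.root_reflectionPerm, P.reflection_apply_root, P.coreflection_apply, map_sub,
      map_smul, LinearMap.sub_apply, LinearMap.smul_apply, smul_eq_mul, P.root_coroot_eq_pairing,
      RootPairing.root', P.pairing_same]
    ring
  induction hw using Subgroup.closure_induction'' with
  | mem x hx =>
    obtain ⟨i, rfl⟩ := hx
    exact key i
  | inv_mem x hx =>
    obtain ⟨i, rfl⟩ := hx
    rw [P.coreflection_inv]
    exact key i
  | one => exact fun j => ⟨j, rfl, fun x => rfl⟩
  | mul x y _ _ h1 h2 =>
    intro j
    obtain ⟨j1, h3, h4⟩ := h2 j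
    obtain ⟨j2, h5, h6⟩ := h1 j1
    refine ⟨j2, ?_, fun v => ?_⟩
    · rw [← h5, ← h3]; rfl
    · rw [← h4, ← h6]; rfl

instance finite_finWeyl [P.IsRootSystem] : Finite (finWeyl P) := by
  choose σ hσ _ using fun w : finWeyl P => exists_coroot_eq_of_mem_finWeyl w.2
  refine Finite.of_injective σ fun w w' h => Subtype.ext (LinearEquiv.toLinearMap_injective ?_)
  refine LinearMap.ext_on_range (v := P.coroot) RootPairing.IsRootSystem.span_coroot_eq_top
    fun j => ?_
  exact (hσ w j).trans ((congrArg (fun σ => P.coroot (σ j)) h).trans (hσ w' j).symm)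

theorem toAffineEquiv_mem_affWeyl {w : N ≃ₗ[ℝ] N} (hw : w ∈ finWeyl P) :
    w.toAffineEquiv ∈ affWeyl P := by
  have key : ∀ i, (P.coreflection i).toAffineEquiv ∈ affWeyl P := by
    intro i
    have : (P.coreflection i).toAffineEquiv = affRefl P i 0 := by
      ext x
      simp [affRefl_apply, P.coreflection_apply]
    rw [this]
    exact Subgroup.subset_closure ⟨(i, 0), rfl⟩
  induction hw using Subgroup.closure_induction'' with
  | mem x hx =>
    obtain ⟨i, rfl⟩ := hx
    exact key i
  | inv_mem x hx =>
    obtain ⟨i, rfl⟩ := hx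
    rw [P.coreflection_inv]
    exact key i
  | one => exact (affWeyl P).one_mem
  | mul x y _ _ h1 h2 => exact (affWeyl P).mul_mem h1 h2

theorem linear_mem_finWeyl {g : N ≃ᵃ[ℝ] N} (hg : g ∈ affWeyl P) : g.linear ∈ finWeyl P := by
  have : affWeyl P ≤ (finWeyl P).comap (AffineEquiv.linearHom) := by
    refine (Subgroup.closure_le _).2 ?_
    rintro _ ⟨⟨j, k⟩, rfl⟩
    change (affRefl P j k).linear ∈ finWeyl P
    have : (affRefl P j k).linear = P.coreflection j := by
      ext v
      rw [linear_affRefl, P.coreflection_apply]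
    rw [this]
    exact Subgroup.subset_closure ⟨j, rfl⟩
  exact this hg

/-- Some positive power of an element of the affine Weyl group is a translation. -/
theorem exists_pow_isTransl [P.IsRootSystem] (g : affWeyl P) :
    ∃ m : ℕ, 0 < m ∧ ∃ v, IsTransl (g ^ m) v := by
  obtain ⟨m, hm, h⟩ := isOfFinOrder_iff_pow_eq_one.1
    (isOfFinOrder_of_finite (⟨g.1.linear, linear_mem_finWeyl g.2⟩ : finWeyl P))
  have h1 : (g ^ m).1.linear = 1 := by
    have h2 := congrArg Subtype.val h
    change (AffineEquiv.linearHom ((g ^ m).1) : N ≃ₗ[ℝ] N) = 1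
    rw [SubmonoidClass.coe_pow, map_pow]
    simpa using h2
  refine ⟨m, hm, (g ^ m).1 0, fun x => ?_⟩
  have := affineEquiv_apply_add (g ^ m).1 0 x
  rw [zero_add, h1] at this
  rw [this, add_comm]
  rfl

variable [P.IsRootSystem] [P.IsCrystallographic] [P.IsReduced] [P.IsIrreducible] (b : P.Base)

/-- A coweight is dominant if it pairs nonnegatively with the simple roots. -/
def IsDominant (v : N) : Prop := ∀ i : b.support, 0 ≤ P.toLinearMap (P.root i) v

/-- On the finite orbit, maximize the functional equal to 1 on every simple coroot: a negative
pairing with αᵢ would let sᵢ increase it. -/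
theorem exists_isDominant (v : N) : ∃ w ∈ finWeyl P, IsDominant b (w v) := by
  let φ : N →ₗ[ℝ] ℝ := b.toCoweightBasis.constr ℝ fun _ => (1 : ℝ)
  have hφ : ∀ i : b.support, φ (P.coroot i) = 1 := fun i => by
    rw [← b.toCoweightBasis_apply, Module.Basis.constr_basis]
  obtain ⟨w, hw⟩ := Finite.exists_max fun w : finWeyl P => φ (w.1 v)
  refine ⟨w.1, w.2, fun i => ?_⟩
  have h := hw (⟨P.coreflection i, Subgroup.subset_closure ⟨i, rfl⟩⟩ * w)
  change φ (P.coreflection i (w.1 v)) ≤ _ at h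
  rw [P.coreflection_apply, map_sub, map_smul, hφ, smul_eq_mul, mul_one] at h
  linarith

/-- The invariant form identifies (α, α)α^∨ with a fixed multiple of α, so the coordinates of the
coroot are those of the root rescaled by positive squared lengths. -/
theorem coroot_coords_nonneg {j : ι} (hj : b.IsPos j) (i : b.support) :
    0 ≤ b.toCoweightBasis.repr (P.coroot j) i := by
  classical
  have := Fintype.ofFinite ι
  have hpos : ∀ j, 0 < P.RootForm (P.root j) (P.root j) := fun j =>
    P.rootForm_pos_of_ne_zero (Submodule.subset_span ⟨j, rfl⟩) (P.ne_zero j)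
  have h1 : P.RootForm (P.root j) (P.root j) • P.coroot j =
      ∑ i : b.support, (P.toLinearMap (P.root j) (fundCoweight b i) *
        P.RootForm (P.root i) (P.root i)) • P.coroot i := by
    rw [P.rootForm_self_smul_coroot]
    conv_lhs => rw [← sum_fundCoweight_smul_root b (P.root j)]
    simp only [map_sum, map_smul, Finset.smul_sum, mul_smul, P.rootForm_self_smul_coroot]
    exact Finset.sum_congr rfl fun i _ => smul_comm _ _ _
  have h2 := congrArg (fun n => b.toCoweightBasis.repr n i) h1
  simp only [map_smul, map_sum, Finsupp.smul_apply, smul_eq_mul, Finsupp.finsetSum_apply,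
    RootPairing.Base.toCoweightBasis_repr_coroot, Finsupp.single_apply, mul_ite, mul_one, mul_zero,
    Finset.sum_ite_eq', Finset.mem_univ, if_true] at h2
  have h3 := mul_nonneg (coords_nonneg_of_isPos b hj i) (hpos i).le
  rw [← h2] at h3
  exact nonneg_of_mul_nonneg_right h3 (hpos j)

/-- A dominant coweight is the highest element of its orbit. -/
theorem repr_sub_apply_nonneg {v : N} (hv : IsDominant b v) {w : N ≃ₗ[ℝ] N} (hw : w ∈ finWeyl P)
    (i : b.support) : 0 ≤ b.toCoweightBasis.repr (v - w v) i := by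
  -- The factor ε moves v into the closed fundamental alcove, where the sign lemmas for affine roots
  -- apply.
  set ε : ℝ := (1 + |P.toLinearMap (P.root (highestRoot b)) v|)⁻¹ with hε
  have hε0 : 0 < ε := inv_pos.2 (by positivity)
  have halc : ∀ i, 0 ≤ sval b i (ε • v) := by
    rintro (_ | i)
    · simp only [sval, map_smul, smul_eq_mul]
      have h1 : ε * (1 + |P.toLinearMap (P.root (highestRoot b)) v|) = 1 :=
        inv_mul_cancel₀ (by positivity)
      nlinarith [le_abs_self (P.toLinearMap (P.root (highestRoot b)) v)]
    · simpa [sval] using mul_nonneg hε0.le (hv i)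
  have halc0 : ∀ i, 0 ≤ sval b i 0 := by rintro (_ | i) <;> simp [sval]
  set g : affWeyl P := ⟨w.toAffineEquiv, toAffineEquiv_mem_affWeyl hw⟩ with hg
  obtain ⟨l0, hl0⟩ := exists_wordProd_eq b g
  obtain ⟨l, hl, hred⟩ := exists_isReducedWord (simpleRefl b) l0
  rw [hl0] at hl
  suffices h : 0 ≤ b.toCoweightBasis.repr (ε • v - g.1 (ε • v)) i by
    have h1 : ε • v - g.1 (ε • v) = ε • (v - w v) := by
      rw [smul_sub]
      congr 1
      exact map_smul w ε v
    rw [h1, map_smul, Finsupp.smul_apply, smul_eq_mul] at h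
    exact nonneg_of_mul_nonneg_right h hε0
  rcases Nat.eq_zero_or_pos l.length with h0 | hlen
  · rw [List.length_eq_zero_iff] at h0
    rw [← hl, h0, wordProd_nil]
    simp
  set u := periodicWord l hlen with hu
  have hpos : ∀ q < l.length, 0 < galRoot b u q (basePt b) := by
    intro q hq
    refine galRoot_pos_of_isReducedWord b ?_
    obtain ⟨n, hn⟩ := Nat.exists_eq_add_of_lt hq
    rw [← initialWord_periodicWord l hlen, hn, show q + n + 1 = (q + 1) + n by ring,
      initialWord_add] at hred
    exact hred.of_append
  have hgal : gal b u l.length = g := by rw [gal, hu, initialWord_periodicWord, hl]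
  -- Along a reduced word for w, each step subtracts a nonnegative multiple of a coroot. The walls
  -- crossed pass through 0, a point of the closed alcove fixed by w, so these coroots belong to
  -- positive finite roots.
  have key : ∀ k ≤ l.length,
      0 ≤ b.toCoweightBasis.repr (ε • v - (gal b u k).1 (ε • v)) i := by
    intro k hk
    induction k with
    | zero => simp [gal, initialWord, wordProd_nil]
    | succ k ih =>
      obtain ⟨j, n, h1, h2⟩ := exists_conj_simpleRefl_eq b (gal b u k) (u k)
      have h3 : (gal b u (k + 1)).1 (ε • v) =
          (gal b u k).1 (ε • v) - sval b (u k) (ε • v) • P.coroot j := by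
        have h4 : gal b u (k + 1) =
            gal b u k * simpleRefl b (u k) * (gal b u k)⁻¹ * gal b u k := by
          rw [gal_succ, inv_mul_cancel_right]
        rw [h4, affWeyl_mul_apply, h2, affRefl_apply', ← h1]
        simp only [affWeyl_inv_apply_self]
      have hmem := galRoot_mem_invSet b hpos (Nat.lt_of_succ_le hk)
      rw [hgal] at hmem
      obtain ⟨ha, hb1, hb2⟩ := hmem
      have hg0 : g.1 0 = 0 := map_zero w
      have e1 : 0 ≤ galRoot b u k 0 := ha.nonneg_of_mem_alcove b hb1.le halc0
      have e2 : galRoot b u k 0 ≤ 0 := by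
        have := (ha.comp g).nonpos_of_mem_alcove b hb2.le halc0
        rwa [hg0] at this
      have hn : n = 0 := by
        have h5 : galRoot b u k 0 = affVal P j n 0 := congrFun h1 0
        rw [affVal_zero] at h5
        have : (n : ℝ) = 0 := by linarith
        exact_mod_cast this
      have hj : b.IsPos j := by
        by_contra hj
        have h5 : galRoot b u k (basePt b) = affVal P j n (basePt b) := congrFun h1 _
        rw [h5, hn] at hb1
        simp only [affVal, Int.cast_zero, sub_zero, basePt, map_smul, map_sum,
          smul_eq_mul] at hb1
        have h6 : ∑ i, P.toLinearMap (P.root j) (fundCoweight b i) ≤ 0 :=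
          Finset.sum_nonpos fun i _ => coords_nonpos_of_not_isPos b hj i
        have h7 := inv_pos.2 (coxNum_pos b)
        nlinarith
      rw [h3]
      have h8 : ε • v - ((gal b u k).1 (ε • v) - sval b (u k) (ε • v) • P.coroot j) =
          (ε • v - (gal b u k).1 (ε • v)) + sval b (u k) (ε • v) • P.coroot j := by abel
      rw [h8, map_add, Finsupp.add_apply, map_smul b.toCoweightBasis.repr (sval b (u k) (ε • v)),
        Finsupp.smul_apply, smul_eq_mul]
      exact add_nonneg (ih (by omega)) (mul_nonneg (halc _) (coroot_coords_nonneg b hj i))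
  have := key l.length le_rfl
  rwa [hgal] at this

/-- Both v - wv and wv - v have nonnegative coroot coordinates. -/
theorem apply_eq_self_of_isDominant {v : N} {w : N ≃ₗ[ℝ] N} (hw : w ∈ finWeyl P)
    (hv : IsDominant b v) (hwv : IsDominant b (w v)) : w v = v := by
  have h1 := repr_sub_apply_nonneg b hv hw
  have h2 := repr_sub_apply_nonneg b hwv ((finWeyl P).inv_mem hw)
  have h3 : w⁻¹ (w v) = v := w.symm_apply_apply v
  rw [h3] at h2
  apply b.toCoweightBasis.repr.injective
  ext i
  have h1 := h1 i
  have h2 := h2 i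
  rw [map_sub, Finsupp.sub_apply] at h1 h2
  linarith

/-- An element of the finite Weyl group fixing a dominant coweight fixes its face. -/
theorem apply_fundCoweight_of_apply_eq_self {v : N} {w : N ≃ₗ[ℝ] N} (hw : w ∈ finWeyl P)
    (hv : IsDominant b v) (hwv : w v = v) {i : b.support}
    (hi : 0 < P.toLinearMap (P.root i) v) : w (fundCoweight b i) = fundCoweight b i := by
  classical
  set ε := P.toLinearMap (P.root i) v
  -- Both v + εωᵢ^∨ and v - εωᵢ^∨ are dominant, because ε is the i-th coordinate of v. As w fixes v,
  -- comparing both with their images gives opposite inequalities for ωᵢ^∨ - wωᵢ^∨.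
  have hd : ∀ s : ℝ, |s| ≤ ε → IsDominant b (v + s • fundCoweight b i) := by
    intro s hs k
    rw [map_add, map_smul, root_fundCoweight, smul_eq_mul]
    split_ifs with h
    · subst h
      have := neg_abs_le s
      linarith
    · simpa using hv k
  have h1 := repr_sub_apply_nonneg b (hd ε (abs_of_pos hi).le) hw
  have h2 := repr_sub_apply_nonneg b (hd (-ε) (by rw [abs_neg, abs_of_pos hi])) hw
  have e : ∀ s : ℝ, v + s • fundCoweight b i - w (v + s • fundCoweight b i) =
      s • (fundCoweight b i - w (fundCoweight b i)) := by
    intro s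
    rw [map_add, map_smul, hwv]
    module
  simp only [e, map_smul, map_sub, Finsupp.smul_apply, Finsupp.sub_apply, smul_eq_mul] at h1 h2
  apply b.toCoweightBasis.repr.injective
  ext k
  have h1 := h1 k
  have h2 := h2 k
  nlinarith

end FiniteWeyl

/-! ### Directions of Coxeter elements; existence and minimality. -/

section Coxeter

variable {ι M N : Type*} [Finite ι] [AddCommGroup M] [Module ℝ M] [AddCommGroup N] [Module ℝ N]
  {P : RootPairing ι ℝ M N} [P.IsRootSystem] [P.IsCrystallographic] [P.IsReduced]
  [P.IsIrreducible] (b : P.Base)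

variable (P) in
/-- The canonical invariant form on the weight space. -/
noncomputable def rform : LinearMap.BilinForm ℝ M :=
  letI := Fintype.ofFinite ι
  P.RootForm

theorem rform_comm (x y : M) : rform P x y = rform P y x := by
  let := Fintype.ofFinite ι
  simpa [rform] using P.rootForm_symmetric.eq x y

theorem rform_self_pos {x : M} (hx : x ≠ 0) : 0 < rform P x x := by
  let := Fintype.ofFinite ι
  exact P.rootForm_pos_of_ne_zero (by simp) hx

theorem aroot_ne_zero (i : Option b.support) : aroot b i ≠ 0 := by
  intro h
  have := aroot_acoroot_self b i
  rw [h] at this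
  simp at this

theorem two_mul_rform_aroot (x : M) (i : Option b.support) :
    2 * rform P x (aroot b i) =
      P.toLinearMap x (acoroot b i) * rform P (aroot b i) (aroot b i) := by
  let := Fintype.ofFinite ι
  obtain ⟨j, -, -, h1, h2, -⟩ := exists_affVal_eq_sval b i
  rw [h1, h2, rform_comm]
  have h := congrArg (fun n => P.toLinearMap x n) (P.rootForm_self_smul_coroot j)
  simp only [map_smul, map_nsmul, smul_eq_mul, P.toLinearMap_apply_apply_Polarization] at h
  rw [mul_comm (P.toLinearMap x (P.coroot j))]
  change 2 * P.RootForm (P.root j) x = P.RootForm (P.root j) (P.root j) * _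
  rw [h]
  simp

/-- The coefficients of the linear relation between the simple affine roots. -/
noncomputable def marks (i : Option b.support) : ℝ :=
  i.elim 1 fun i => P.toLinearMap (P.root (highestRoot b)) (fundCoweight b i)

theorem marks_pos (i : Option b.support) : 0 < marks b i := by
  cases i
  · exact one_pos
  · exact coords_highestRoot_pos b _

theorem sum_marks_smul_aroot : ∑ i, marks b i • aroot b i = 0 := by
  rw [Fintype.sum_option]
  simp only [marks, aroot, Option.elim, one_smul]
  rw [sum_fundCoweight_smul_root, neg_add_cancel]

theorem eq_mul_marks_of_sum_eq_zero {c : Option b.support → ℝ} (h : ∑ i, c i • aroot b i = 0)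
    (i : Option b.support) : c i = c none * marks b i := by
  have h1 : ∑ i : b.support, (c (some i) - c none * marks b (some i)) • P.root i = 0 := by
    have h2 : ∑ i, (c i - c none * marks b i) • aroot b i = 0 := by
      simp only [sub_smul, mul_smul, Finset.sum_sub_distrib, h, ← Finset.smul_sum,
        sum_marks_smul_aroot, smul_zero, sub_zero]
    rw [Fintype.sum_option] at h2
    simpa [marks, aroot] using h2
  cases i with
  | none => simp [marks]
  | some i =>
    have h3 := Fintype.linearIndependent_iff.1 b.linearIndepOn_root.linearIndependent _ h1 i
    linarith

/-- The coefficients of a linear relation between the simple affine coroots. -/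
noncomputable def comarks (i : Option b.support) : ℝ :=
  marks b i * rform P (aroot b i) (aroot b i) / 2

theorem comarks_pos (i : Option b.support) : 0 < comarks b i :=
  div_pos (mul_pos (marks_pos b i) (rform_self_pos (aroot_ne_zero b i))) two_pos

theorem comarks_mul (x : M) (i : Option b.support) :
    comarks b i * P.toLinearMap x (acoroot b i) = marks b i * rform P x (aroot b i) := by
  have := two_mul_rform_aroot b x i
  unfold comarks
  linear_combination marks b i / 2 * (-this)

theorem sum_comarks_smul_acoroot : ∑ i, comarks b i • acoroot b i = 0 := by
  refine coweight_ext b fun j => ?_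
  simp only [map_sum, map_smul, smul_eq_mul, comarks_mul, map_zero]
  have := congrArg (fun y => rform P (P.root j) y) (sum_marks_smul_aroot b)
  simpa using this

/-- Subtracting the multiple of the comark relation that cancels the affine coefficient leaves a
relation between the simple coroots, which are independent. -/
theorem exists_eq_mul_comarks_of_sum_eq_zero {c : Option b.support → ℝ}
    (h : ∑ i, c i • acoroot b i = 0) : ∃ r, ∀ i, c i = r * comarks b i := by
  set r := c none / comarks b none with hr
  have h0 : c none - r * comarks b none = 0 := by
    rw [hr, div_mul_cancel₀ _ (comarks_pos b none).ne', sub_self]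
  have h1 : ∑ i : b.support, (c (some i) - r * comarks b (some i)) • P.coroot i = 0 := by
    have h2 : ∑ i, (c i - r * comarks b i) • acoroot b i = 0 := by
      simp only [sub_smul, mul_smul, Finset.sum_sub_distrib, h, ← Finset.smul_sum,
        sum_comarks_smul_acoroot, smul_zero, sub_zero]
    rw [Fintype.sum_option, h0] at h2
    simpa [acoroot] using h2
  refine ⟨r, fun i => ?_⟩
  cases i with
  | none => linarith
  | some i =>
    have h3 := Fintype.linearIndependent_iff.1 b.linearIndepOn_coroot.linearIndependent _ h1 i
    linarith

theorem eq_zero_of_forall_aroot {v : N} (h : ∀ i, P.toLinearMap (aroot b i) v = 0) : v = 0 :=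
  coweight_ext b fun i => by rw [map_zero]; exact h (some i)

/-- The values `y` are those met when the simple reflections of a word are applied successively
to `v`. -/
def Chain (y : Option b.support → ℝ) : List (Option b.support) → N → Prop
  | [], _ => True
  | i :: l, v => P.toLinearMap (aroot b i) v = y i ∧ Chain y l (v - y i • acoroot b i)

variable {b}

theorem Chain.congr {y y' : Option b.support → ℝ} {l : List (Option b.support)} {v : N}
    (h : Chain b y l v) (hy : ∀ i ∈ l, y i = y' i) : Chain b y' l v := by
  induction l generalizing v with
  | nil => trivial
  | cons i l ih =>
    have hi : y i = y' i := hy i (by simp)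
    exact ⟨hi ▸ h.1, ih (hi ▸ h.2) fun k hk => hy k (by simp [hk])⟩

theorem exists_chain {l : List (Option b.support)} (hl : l.Nodup) (v : N) :
    ∃ y, Chain b y l v := by
  classical
  induction l generalizing v with
  | nil => exact ⟨0, trivial⟩
  | cons i l ih =>
    rw [List.nodup_cons] at hl
    obtain ⟨y, hy⟩ := ih hl.2 (v - P.toLinearMap (aroot b i) v • acoroot b i)
    refine ⟨Function.update y i (P.toLinearMap (aroot b i) v), by simp, ?_⟩
    rw [Function.update_self]
    refine hy.congr fun k hk => ?_
    rw [Function.update_of_ne]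
    rintro rfl
    exact hl.1 hk

theorem linear_wordProd_cons_inv (i : Option b.support) (l : List (Option b.support)) (v : N) :
    (wordProd (simpleRefl b) (i :: l))⁻¹.1.linear v = (wordProd (simpleRefl b) l)⁻¹.1.linear
      (v - P.toLinearMap (aroot b i) v • acoroot b i) := by
  rw [wordProd_cons, mul_inv_rev, simpleRefl_inv, ← linear_simpleRefl]
  rfl

theorem Chain.linear_inv_apply {y : Option b.support → ℝ} {l : List (Option b.support)} {v : N}
    (h : Chain b y l v) : (wordProd (simpleRefl b) l)⁻¹.1.linear v =
      v - (l.map fun i => y i • acoroot b i).sum := by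
  induction l generalizing v with
  | nil =>
    rw [wordProd_nil, inv_one]
    simp only [List.map_nil, List.sum_nil, sub_zero]
    rfl
  | cons i l ih =>
    rw [linear_wordProd_cons_inv, h.1, ih h.2, List.map_cons, List.sum_cons]
    abel

theorem Chain.apply_eq {y : Option b.support → ℝ} {l₁ l₂ : List (Option b.support)}
    {i : Option b.support} {v : N} (h : Chain b y (l₁ ++ i :: l₂) v) :
    P.toLinearMap (aroot b i) ((wordProd (simpleRefl b) l₁)⁻¹.1.linear v) = y i := by
  induction l₁ generalizing v with
  | nil => exact h.1
  | cons k l₁ ih =>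
    obtain ⟨h1, h2⟩ := h
    rw [linear_wordProd_cons_inv, h1]
    exact ih h2

/-- This links the two descriptions: the values of a chain are the variations along v of the wall
roots of the gallery. -/
theorem Chain.galDir_eq {y : Option b.support → ℝ} {l : List (Option b.support)}
    {hl : 0 < l.length} {v : N} (h : Chain b y l v) {r : ℕ} (hr : r < l.length) :
    galDir b (periodicWord l hl) r v = y (periodicWord l hl r) := by
  obtain ⟨n, hn⟩ := Nat.exists_eq_add_of_lt hr
  have hsplit := initialWord_periodicWord l hl
  rw [hn, show r + n + 1 = (r + 1) + n by ring, initialWord_add, initialWord_succ,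
    List.append_assoc, List.singleton_append] at hsplit
  rw [← hsplit] at h
  exact h.apply_eq

theorem Chain.sub_smul {y y' : Option b.support → ℝ} {l : List (Option b.support)} {v v' : N}
    (h : Chain b y l v) (h' : Chain b y' l v') (r : ℝ) :
    Chain b (fun i => y i - r * y' i) l (v - r • v') := by
  induction l generalizing v v' with
  | nil => trivial
  | cons i l ih =>
    refine ⟨?_, ?_⟩
    · rw [map_sub, map_smul, h.1, h'.1, smul_eq_mul]
    · convert ih h.2 h'.2 using 1
      module

theorem Chain.eq_zero {y : Option b.support → ℝ} {l : List (Option b.support)} {v : N}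
    (h : Chain b y l v) (hy : ∀ i, y i = 0) : ∀ i ∈ l, P.toLinearMap (aroot b i) v = 0 := by
  induction l with
  | nil => simp
  | cons i l ih =>
    obtain ⟨h1, h2⟩ := h
    rw [hy, zero_smul, sub_zero] at h2
    intro k hk
    rcases List.mem_cons.1 hk with rfl | hk
    · rw [h1, hy]
    · exact ih h2 k hk

theorem sum_map_eq_sum_univ {A B : Type*} [AddCommMonoid A] [Fintype B] {l : List B}
    (hl : l.Nodup) (hall : ∀ i, i ∈ l) (f : B → A) : (l.map f).sum = ∑ i, f i := by
  classical
  rw [← List.sum_toFinset f hl, Finset.eq_univ_iff_forall.2 fun i => List.mem_toFinset.2 (hall i)]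

/-- Back substitution: putting a letter i in front replaces eₖ by eₖ - comarkᵢ⟨aₖ, aᵢ^∨⟩ and sets eᵢ
= -comarkᵢ. With S the weighted sum over the later letters, the total then drops by ½|mᵢaᵢ|² + (S,
mᵢaᵢ), exactly the growth of ½|S|². -/
theorem exists_chain_values (l : List (Option b.support)) (hl : l.Nodup) :
    ∃ e : Option b.support → ℝ,
      (∀ v, (∀ i ∈ l, P.toLinearMap (aroot b i) v = e i) → Chain b (fun i => -comarks b i) l v) ∧
      (l.map fun i => marks b i * e i).sum = -(rform P
        (l.map fun i => marks b i • aroot b i).sum (l.map fun i => marks b i • aroot b i).sum) / 2 := by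
  classical
  induction l with
  | nil => exact ⟨0, fun v _ => trivial, by simp⟩
  | cons i l ih =>
    rw [List.nodup_cons] at hl
    obtain ⟨e, he, hsum⟩ := ih hl.2
    set S := (l.map fun i => marks b i • aroot b i).sum with hS
    set e' : Option b.support → ℝ := Function.update
      (fun k => e k - comarks b i * P.toLinearMap (aroot b k) (acoroot b i)) i
      (-comarks b i) with he'
    have hne : ∀ k ∈ l, e' k = e k - comarks b i * P.toLinearMap (aroot b k) (acoroot b i) := by
      intro k hk
      rw [he', Function.update_of_ne]
      rintro rfl
      exact hl.1 hk
    have hself : e' i = -comarks b i := by rw [he', Function.update_self]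
    refine ⟨e', fun v hv => ⟨?_, he _ fun k hk => ?_⟩, ?_⟩
    · rw [hv i (by simp), hself]
    · rw [map_sub, map_smul, hv k (by simp [hk]), hne k hk, smul_eq_mul]
      ring
    · have h1 : (l.map fun k => marks b k * e' k).sum =
          (l.map fun k => marks b k * e k).sum - comarks b i * P.toLinearMap S (acoroot b i) := by
        have h2 : ∀ l' : List (Option b.support), (∀ k ∈ l', k ∈ l) →
            (l'.map fun k => marks b k * e' k).sum = (l'.map fun k => marks b k * e k).sum -
              comarks b i *
                P.toLinearMap (l'.map fun i => marks b i • aroot b i).sum (acoroot b i) := by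
          intro l' hl'
          induction l' with
          | nil => simp
          | cons k l' ih' =>
            simp only [List.map_cons, List.sum_cons, map_add, LinearMap.add_apply, map_smul,
              LinearMap.smul_apply, smul_eq_mul]
            rw [ih' fun m hm => hl' m (by simp [hm]), hne k (hl' k (by simp))]
            ring
        exact h2 l fun k hk => hk
      simp only [List.map_cons, List.sum_cons, h1, hsum, hself, ← hS, map_add,
        LinearMap.add_apply, map_smul, LinearMap.smul_apply, smul_eq_mul, comarks_mul]
      rw [rform_comm (aroot b i) S]
      unfold comarks
      ring

/-- The direction in which the gallery of a Coxeter element goes to infinity. -/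
theorem exists_chain_neg_comarks {l : List (Option b.support)} (hl : l.Nodup)
    (hall : ∀ i, i ∈ l) : ∃ v, Chain b (fun i => -comarks b i) l v := by
  classical
  obtain ⟨e, he, hsum⟩ := exists_chain_values l hl
  -- When every letter occurs S = 0, so Σ mᵢeᵢ = 0. Hence the vector with the prescribed values on
  -- the simple roots also has the prescribed value on -ξ.
  rw [sum_map_eq_sum_univ hl hall, sum_map_eq_sum_univ hl hall, sum_marks_smul_aroot,
    map_zero, neg_zero, zero_div, Fintype.sum_option] at hsum
  refine ⟨∑ i, e (some i) • fundCoweight b i, he _ fun i _ => ?_⟩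
  cases i with
  | none =>
    simp only [marks, Option.elim, one_mul] at hsum
    simp only [aroot, map_neg, LinearMap.neg_apply, map_sum, map_smul, smul_eq_mul]
    simp only [mul_comm (e (some _)), neg_mul, Finset.sum_neg_distrib]
    linarith
  | some i => simp [aroot, root_fundCoweight]

theorem linear_inv_apply_eq_self {g : affWeyl P} {v : N} : (g⁻¹).1.linear v = v ↔
    g.1.linear v = v := by
  change g.1.linear.symm v = v ↔ _
  rw [LinearEquiv.symm_apply_eq, eq_comm]

theorem Chain.linear_apply_eq_self {l : List (Option b.support)} (hl : l.Nodup)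
    (hall : ∀ i, i ∈ l) {v : N} (h : Chain b (fun i => -comarks b i) l v) :
    (wordProd (simpleRefl b) l).1.linear v = v := by
  rw [← linear_inv_apply_eq_self, h.linear_inv_apply, sum_map_eq_sum_univ hl hall]
  simp only [neg_smul, Finset.sum_neg_distrib, sum_comarks_smul_acoroot, neg_zero, sub_zero]

/-- The chain values of a fixed vector are the coefficients of a relation between the coroots, hence
proportional to the comarks. Subtracting a multiple of v leaves a chain of zeros, whose vector is
killed by all simple roots. -/
theorem Chain.exists_eq_smul {l : List (Option b.support)} (hl : l.Nodup)
    (hall : ∀ i, i ∈ l) {v w : N} (h : Chain b (fun i => -comarks b i) l v)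
    (hw : (wordProd (simpleRefl b) l).1.linear w = w) : ∃ r : ℝ, w = r • v := by
  obtain ⟨y, hy⟩ := exists_chain hl w
  rw [← linear_inv_apply_eq_self, hy.linear_inv_apply, sum_map_eq_sum_univ hl hall,
    sub_eq_self] at hw
  obtain ⟨r, hr⟩ := exists_eq_mul_comarks_of_sum_eq_zero b hw
  refine ⟨-r, ?_⟩
  rw [← sub_eq_zero]
  refine eq_zero_of_forall_aroot b fun i => (hy.sub_smul h (-r)).eq_zero (fun k => ?_) i (hall i)
  rw [hr]
  ring

theorem rayRoots_smul {r : ℝ} (hr : 0 < r) (v : N) : rayRoots b (r • v) = rayRoots b v := by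
  ext f
  refine exists_congr fun j => exists_congr fun k => and_congr_right fun _ =>
    and_congr_right fun _ => ?_
  rw [map_smul, smul_eq_mul]
  exact ⟨fun h => neg_of_mul_neg_right h hr.le, fun h => mul_neg_of_pos_of_neg hr h⟩

theorem IsTransl.linear_apply_of_pow {g : affWeyl P} {m : ℕ} {v : N} (h : IsTransl (g ^ m) v) :
    g.1.linear v = v := by
  have h1 : g.1 ((g ^ m).1 0) = (g ^ m).1 (g.1 0) := by
    rw [← affWeyl_mul_apply, ← affWeyl_mul_apply, ← pow_succ, ← pow_succ']
  rw [h, h, zero_add, ← zero_add v, affineEquiv_apply_add, zero_add] at h1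
  exact add_left_cancel h1

/-- The limit element of a Coxeter element exists, and its inversion set is given by the direction
fixed by the Coxeter element. -/
theorem exists_isInfPower_coxeter {l : List (Option b.support)} (hl : l.Nodup)
    (hall : ∀ i, i ∈ l) {v : N} (h : Chain b (fun i => -comarks b i) l v) :
    ∃ x, IsInfPower (simpleRefl b) (wordProd (simpleRefl b) l) x ∧
      x.inv = reflSet (rayRoots b v) := by
  have hlen : 0 < l.length := List.length_pos_of_mem (hall none)
  have hdir : ∀ r < l.length, galDir b (periodicWord l hlen) r v < 0 := by
    intro r hr
    rw [h.galDir_eq hr]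
    exact neg_lt_zero.2 (comarks_pos b _)
  have hred := isInfReducedWord_periodicWord b (hl := hlen) (h.linear_apply_eq_self hl hall) hdir
  obtain ⟨x, hx⟩ := exists_isInfPower b hred
  refine ⟨x, hx, ?_⟩
  obtain ⟨m, hm, w, hw⟩ := exists_pow_isTransl (wordProd (simpleRefl b) l)
  rw [hx.inv_eq b hm hw]
  -- The translation vector of a power of c is fixed by c, hence equals rv. The first wall root
  -- decreases along both rv and v, so r > 0.
  obtain ⟨r, rfl⟩ := h.exists_eq_smul hl hall hw.linear_apply_of_pow
  have hrange := range_galRoot_periodicWord b hred hm hw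
  obtain ⟨j, k, h1, -, h2⟩ := hrange ▸ Set.mem_range_self (f := galRoot b (periodicWord l hlen)) 0
  have h3 : P.toLinearMap (P.root j) v < 0 := by
    have h4 := hdir 0 hlen
    have h5 := galRoot_add b (periodicWord l hlen) 0 0 v
    rw [h1, affVal_add] at h5
    linarith
  have hr : 0 < r := by
    rw [map_smul, smul_eq_mul] at h2
    exact pos_of_mul_neg_left h2 h3.le
  rw [rayRoots_smul hr]

/-- A vector spanning the fixed space of an element of the finite Weyl group lies on the ray of a
conjugate of a fundamental coweight. -/
theorem exists_eq_smul_fundCoweight {g : N ≃ₗ[ℝ] N} (hg : g ∈ finWeyl P) {v : N} (hv : v ≠ 0)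
    (hgv : g v = v) (hfix : ∀ w, g w = w → ∃ r : ℝ, w = r • v) :
    ∃ w ∈ finWeyl P, ∃ i, ∃ q : ℝ, 0 < q ∧ v = q • w (fundCoweight b i) := by
  classical
  obtain ⟨w, hw, hd⟩ := exists_isDominant b v
  have hwv : w v ≠ 0 := fun h => hv (by simpa using h)
  obtain ⟨i, hi⟩ : ∃ i : b.support, 0 < P.toLinearMap (P.root i) (w v) := by
    by_contra! hneg
    exact hwv (coweight_ext b fun i => by rw [map_zero]; exact le_antisymm (hneg i) (hd i))
  have hcancel : ∀ x, w⁻¹ (w x) = x := fun x => w.symm_apply_apply x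
  have hcancel' : ∀ x, w (w⁻¹ x) = x := fun x => w.apply_symm_apply x
  -- The conjugate wgw⁻¹ fixes the dominant vector wv, so it fixes ωᵢ^∨; pulled back by w, this
  -- coweight falls in the line fixed by g.
  have h1 := apply_fundCoweight_of_apply_eq_self b
    ((finWeyl P).mul_mem ((finWeyl P).mul_mem hw hg) ((finWeyl P).inv_mem hw)) hd
    (by change w (g (w⁻¹ (w v))) = w v; rw [hcancel, hgv]) hi
  change w (g (w⁻¹ (fundCoweight b i))) = fundCoweight b i at h1
  obtain ⟨r, hr⟩ := hfix (w⁻¹ (fundCoweight b i)) (by rw [← hcancel (g _), h1])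
  have h2 : fundCoweight b i = r • w v := by rw [← map_smul, ← hr, hcancel']
  have h3 : 1 = r * P.toLinearMap (P.root i) (w v) := by
    have := root_fundCoweight b i i
    rw [h2, map_smul, if_pos rfl] at this
    exact this.symm
  have hr0 : 0 < r := by
    by_contra hneg
    nlinarith
  refine ⟨w⁻¹, (finWeyl P).inv_mem hw, i, r⁻¹, inv_pos.2 hr0, ?_⟩
  rw [h2, map_smul, hcancel, smul_smul, inv_mul_cancel₀ hr0.ne', one_smul]

/-- After applying w⁻¹, the vector is killed by every simple root except αᵢ. This is the spanning
hypothesis needed for minimality. -/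
theorem exists_eq_smul_of_orthogonal {w : N ≃ₗ[ℝ] N} (hw : w ∈ finWeyl P) (i : b.support) {q : ℝ}
    (hq : 0 < q) {u : N}
    (hu : ∀ j, P.toLinearMap (P.root j) (q • w (fundCoweight b i)) = 0 →
      P.toLinearMap (P.root j) u = 0) : ∃ r : ℝ, u = r • q • w (fundCoweight b i) := by
  classical
  have hcancel' : w (w⁻¹ u) = u := w.apply_symm_apply u
  have h1 : w⁻¹ u = P.toLinearMap (P.root i) (w⁻¹ u) • fundCoweight b i := by
    refine coweight_ext b fun k => ?_
    rw [map_smul, root_fundCoweight, smul_eq_mul]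
    split_ifs with hk
    · rw [hk, mul_one]
    · obtain ⟨j', -, hj'⟩ := exists_coroot_eq_of_mem_finWeyl hw k
      rw [← hj', hcancel', hu, mul_zero]
      rw [map_smul, hj', root_fundCoweight, if_neg hk, smul_zero]
  refine ⟨P.toLinearMap (P.root i) (w⁻¹ u) / q, ?_⟩
  rw [smul_smul, div_mul_cancel₀ _ hq.ne', ← map_smul, ← h1, hcancel']

/-- The adjugate of the Cartan matrix C writes det(C)ωᵢ^∨ as an integral combination of coroots, so
the infimum is over a nonempty set and is not the default 0. -/
theorem coweightIndex_spec (i : b.support) : 0 < coweightIndex b i ∧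
    coweightIndex b i • fundCoweight b i ∈ corootLattice b := by
  classical
  refine Nat.sInf_mem (s := {k : ℕ | 0 < k ∧ k • fundCoweight b i ∈ corootLattice b}) ?_
  set C := b.cartanMatrix with hC
  have hdet : C.det ≠ 0 :=
    (Matrix.nondegenerate_iff_det_ne_zero).1 b.cartanMatrix_nondegenerate
  have h1 : C.det • fundCoweight b i = ∑ k : b.support, C.adjugate k i • P.coroot k := by
    refine coweight_ext b fun j => ?_
    simp only [map_zsmul, map_sum, P.root_coroot_eq_pairing, root_fundCoweight]
    have h2 := congrFun (congrFun (Matrix.mul_adjugate C) j) i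
    rw [Matrix.mul_apply] at h2
    have h3 := congrArg (Int.cast (R := ℝ)) h2
    have h4 : ∀ k : b.support, ((C j k : ℤ) : ℝ) = P.pairing j k := fun k => by
      have := P.algebraMap_pairingIn ℤ (j : ι) (k : ι)
      simpa [hC, RootPairing.Base.cartanMatrixIn_def] using this
    simp only [Int.cast_sum, Int.cast_mul, h4, Matrix.smul_apply, Matrix.one_apply] at h3
    simp only [zsmul_eq_mul]
    simp only [mul_comm (Int.cast _ : ℝ)] at h3 ⊢
    rw [h3]
    split_ifs <;> simp
  have h2 : C.det • fundCoweight b i ∈ corootLattice b := by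
    rw [h1]
    exact Submodule.sum_mem _ fun k _ => Submodule.smul_mem _ _
      (Submodule.subset_span ⟨k, k.2, rfl⟩)
  refine ⟨C.det.natAbs, Int.natAbs_pos.2 hdet, ?_⟩
  rw [← natCast_zsmul, Int.natCast_natAbs]
  rcases abs_choice C.det with h | h <;> rw [h]
  · exact h2
  · rw [neg_smul]
    exact Submodule.neg_mem _ h2

theorem constVAdd_mem_affWeyl {v : N} (hv : v ∈ corootLattice b) {w : N ≃ₗ[ℝ] N}
    (hw : w ∈ finWeyl P) : AffineEquiv.constVAdd ℝ N (w v) ∈ affWeyl P := by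
  have h1 : AffineEquiv.constVAdd ℝ N v ∈ affWeyl P := by
    induction hv using Submodule.span_induction with
    | mem x hx =>
      obtain ⟨j, -, rfl⟩ := hx
      have : AffineEquiv.constVAdd ℝ N (P.coroot j) = affRefl P j 1 * affRefl P j 0 := by
        ext x
        simp only [AffineEquiv.constVAdd_apply, vadd_eq_add, AffineEquiv.coe_mul,
          Function.comp_apply, affRefl_apply, map_sub, map_smul, P.root_coroot_eq_pairing,
          P.pairing_same, smul_eq_mul, Int.cast_zero, Int.cast_one]
        module
      rw [this]
      exact (affWeyl P).mul_mem (affRefl_mem_affWeyl j 1) (affRefl_mem_affWeyl j 0)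
    | zero =>
      rw [AffineEquiv.constVAdd_zero]
      exact (affWeyl P).one_mem
    | add x y _ _ hx hy =>
      rw [AffineEquiv.constVAdd_add]
      exact (affWeyl P).mul_mem hx hy
    | smul n x _ hx =>
      rw [AffineEquiv.constVAdd_zsmul]
      exact (affWeyl P).zpow_mem hx n
  have h2 : AffineEquiv.constVAdd ℝ N (w v) =
      w.toAffineEquiv * AffineEquiv.constVAdd ℝ N v * (w.toAffineEquiv)⁻¹ := by
    ext x
    change w v + x = w (v + w.symm x)
    rw [map_add, w.apply_symm_apply]
  rw [h2]
  have h3 := toAffineEquiv_mem_affWeyl hw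
  exact (affWeyl P).mul_mem ((affWeyl P).mul_mem h3 h1) ((affWeyl P).inv_mem h3)

theorem isTransl_of_eq_constVAdd {t : affWeyl P} {v : N}
    (h : (t : N ≃ᵃ[ℝ] N) = AffineEquiv.constVAdd ℝ N v) : IsTransl t v := fun x => by
  rw [h, AffineEquiv.constVAdd_apply, vadd_eq_add, add_comm]

/-- The positive factor kᵢ does not change the ray, and a limit element is determined by its
inversion set, so translations can be eliminated from the definition. -/
theorem isCoxeterNode_iff (i : b.support) : IsCoxeterNode b i ↔ ∃ w ∈ finWeyl P,
    ∃ c x, IsCoxeterElement (simpleRefl b) c ∧ IsInfPower (simpleRefl b) c x ∧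
      x.inv = reflSet (rayRoots b (w (fundCoweight b i))) := by
  classical
  obtain ⟨hk, hmem⟩ := coweightIndex_spec i
  have hk' : (0 : ℝ) < coweightIndex b i := by exact_mod_cast hk
  have hw' : ∀ w : N ≃ₗ[ℝ] N, w (coweightIndex b i • fundCoweight b i) =
      (coweightIndex b i : ℝ) • w (fundCoweight b i) := fun w => by
    rw [map_nsmul, Nat.cast_smul_eq_nsmul]
  constructor
  · rintro ⟨w, hw, t, c, x, ht, hc, htx, hcx⟩
    refine ⟨w, hw, c, x, hc, hcx, ?_⟩
    have h1 := isTransl_of_eq_constVAdd ht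
    rw [htx.inv_eq b one_pos (by rwa [pow_one]), hw', rayRoots_smul hk']
  · rintro ⟨w, hw, c, x, hc, hcx, hx⟩
    have h1 : IsTransl (⟨_, constVAdd_mem_affWeyl hmem hw⟩ : affWeyl P)
        (w (coweightIndex b i • fundCoweight b i)) := isTransl_of_eq_constVAdd rfl
    obtain ⟨y, hy⟩ := h1.exists_isInfPower b <| by
      rw [hw']
      refine smul_ne_zero hk'.ne' fun h0 => ?_
      have h2 : fundCoweight b i = 0 := w.map_eq_zero_iff.1 h0
      have h3 := root_fundCoweight b i i
      rw [h2, map_zero, if_pos rfl] at h3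
      exact zero_ne_one h3
    have hxy : y = x := by
      apply LimitElement.inv_injective
      rw [hx, hy.inv_eq b one_pos (by rwa [pow_one]), hw', rayRoots_smul hk']
    exact ⟨w, hw, _, c, x, rfl, hc, hxy ▸ hy, hcx⟩

/-- The limit element of a Coxeter element lies on the ray of a conjugate of a fundamental
coweight. -/
theorem IsCoxeterElement.exists_limit {c : affWeyl P} (hc : IsCoxeterElement (simpleRefl b) c) :
    ∃ w ∈ finWeyl P, ∃ i x, IsInfPower (simpleRefl b) c x ∧
      x.inv = reflSet (rayRoots b (w (fundCoweight b i))) := by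
  obtain ⟨l, hl, hall, rfl⟩ := hc
  obtain ⟨v, hv⟩ := exists_chain_neg_comarks hl hall
  have hv0 : v ≠ 0 := by
    rintro rfl
    cases l with
    | nil => exact absurd (hall none) (by simp)
    | cons i l =>
      have h1 := hv.1
      rw [map_zero] at h1
      have := comarks_pos b i
      linarith
  obtain ⟨w, hw, i, q, hq, rfl⟩ := exists_eq_smul_fundCoweight (b := b)
    (linear_mem_finWeyl (wordProd (simpleRefl b) l).2) hv0 (hv.linear_apply_eq_self hl hall)
    fun w hw => hv.exists_eq_smul hl hall hw
  obtain ⟨x, hx, hxinv⟩ := exists_isInfPower_coxeter hl hall hv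
  rw [rayRoots_smul hq] at hxinv
  exact ⟨w, hw, i, x, hx, hxinv⟩

theorem IsInfPower.eq_of_isInfPower {g : affWeyl P} {x y : LimitElement (simpleRefl b)}
    (hx : IsInfPower (simpleRefl b) g x) (hy : IsInfPower (simpleRefl b) g y) : y = x := by
  obtain ⟨m, hm, v, hv⟩ := exists_pow_isTransl g
  apply LimitElement.inv_injective
  rw [hx.inv_eq b hm hv, hy.inv_eq b hm hv]

theorem exists_isCoxeterElement : ∃ c, IsCoxeterElement (simpleRefl b) c :=
  ⟨_, Finset.univ.toList, Finset.nodup_toList _, fun i => Finset.mem_toList.2 (Finset.mem_univ i),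
    rfl⟩

theorem exists_isCoxeterNode : ∃ i, IsCoxeterNode b i := by
  obtain ⟨c, hc⟩ := exists_isCoxeterElement (b := b)
  obtain ⟨w, hw, i, x, hx, hxinv⟩ := hc.exists_limit
  exact ⟨i, (isCoxeterNode_iff i).2 ⟨w, hw, c, x, hc, hx, hxinv⟩⟩

theorem IsCoxeterElement.exists_isMin {c : affWeyl P} (hc : IsCoxeterElement (simpleRefl b) c) :
    ∃ x : LimitElement (simpleRefl b),
      (∀ y, IsInfPower (simpleRefl b) c y ↔ y = x) ∧ IsMin x := by
  obtain ⟨w, hw, i, x, hx, hxinv⟩ := hc.exists_limit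
  refine ⟨x, fun y => ⟨fun hy => hx.eq_of_isInfPower hy, fun h => h ▸ hx⟩, ?_⟩
  refine isMin_of_inv_eq_rayRoots b hxinv fun u hu => ?_
  simpa using exists_eq_smul_of_orthogonal hw i one_pos (u := u) (by simpa using hu)

end Coxeter

/-! ### Rotations and commutations of words over a forest. -/

section Conjugacy

variable {B : Type*} {adj : B → B → Prop}

/-- Words related by rotations and by swaps of neighbouring non-adjacent letters. -/
inductive RotSwap (adj : B → B → Prop) : List B → List B → Prop
  | refl (l) : RotSwap adj l l
  | symm {l l'} : RotSwap adj l l' → RotSwap adj l' l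
  | trans {l l' l''} : RotSwap adj l l' → RotSwap adj l' l'' → RotSwap adj l l''
  | rot (x l) : RotSwap adj (x :: l) (l ++ [x])
  | swap (p) {x y} (q) : ¬ adj x y → RotSwap adj (p ++ x :: y :: q) (p ++ y :: x :: q)

namespace RotSwap

theorem perm {l l' : List B} (h : RotSwap adj l l') : l.Perm l' := by
  induction h with
  | refl => exact List.Perm.refl _
  | symm _ ih => exact ih.symm
  | trans _ _ ih ih' => exact ih.trans ih'
  | rot x l => exact (List.perm_append_singleton x l).symm
  | swap p q _ => exact (List.Perm.swap _ _ _).append_left p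

theorem isConj {G : Type*} [Group G] {s : B → G} (hs : ∀ x y, ¬ adj x y → s x * s y = s y * s x)
    {l l' : List B} (h : RotSwap adj l l') : IsConj (wordProd s l) (wordProd s l') := by
  induction h with
  | refl => exact IsConj.refl _
  | symm _ ih => exact ih.symm
  | trans _ _ ih ih' => exact ih.trans ih'
  | rot x l =>
    rw [wordProd_cons, wordProd_append, wordProd_singleton]
    exact isConj_iff.2 ⟨(s x)⁻¹, by group⟩
  | swap p q h =>
    simp only [wordProd_append, wordProd_cons, ← mul_assoc _ _ (wordProd s q), hs _ _ h]
    exact IsConj.refl _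

theorem append_comm (l l' : List B) : RotSwap adj (l ++ l') (l' ++ l) := by
  induction l generalizing l' with
  | nil => rw [List.append_nil]; exact refl _
  | cons x l ih =>
    have h := ih (l' ++ [x])
    rw [List.append_assoc, List.singleton_append, ← List.append_assoc] at h
    exact (rot x (l ++ l')).trans h

theorem move (p : List B) {x : B} {l : List B} (h : ∀ y ∈ l, ¬ adj x y) :
    RotSwap adj (p ++ x :: l) (p ++ (l ++ [x])) := by
  induction l generalizing p with
  | nil => exact refl _
  | cons y l ih =>
    have h1 := ih (p ++ [y]) fun z hz => h z (by simp [hz])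
    simp only [List.append_assoc, List.singleton_append] at h1
    exact (swap p l (h y (by simp))).trans h1

/-- Moves on the remaining letters lift past a leaf v. When the rotated letter x is not adjacent to
v they commute; when it is the neighbour u, v commutes with all the other letters and can be carried
around them. -/
theorem cons {l l' : List B} (hl : RotSwap adj l l') {v u : B}
    (hn : l.Nodup) (hu : ∀ y ∈ l, adj v y → y = u) : RotSwap adj (v :: l) (v :: l') := by
  induction hl with
  | refl => exact refl _
  | symm h ih =>
    have hp := h.perm
    exact (ih (hp.nodup_iff.2 hn) fun y hy => hu y (hp.mem_iff.1 hy)).symm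
  | trans h _ ih ih' =>
    have hp := h.perm
    exact (ih hn hu).trans (ih' (hp.nodup_iff.1 hn) fun y hy => hu y (hp.mem_iff.2 hy))
  | rot x l =>
    by_cases hx : adj v x
    · obtain rfl := hu x (by simp) hx
      have hl : ∀ y ∈ l, ¬ adj v y := fun y hy h => by
        rw [hu y (by simp [hy]) h] at hy
        exact (List.nodup_cons.1 hn).1 hy
      exact ((rot v (x :: l)).trans (move [x] hl).symm).trans (rot x (v :: l))
    · exact (swap [] l hx).trans (rot x (v :: l))
  | swap p q h => exact swap (v :: p) q h

/-- In a forest all arrangements of a set of letters are related by rotations and swaps. -/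
theorem of_perm
    (hforest : ∀ S : Finset B, S.Nonempty → ∃ v ∈ S, ∃ u, ∀ y ∈ S, adj v y → y = u)
    {l l' : List B} (hl : l.Nodup) (h : l.Perm l') : RotSwap adj l l' := by
  classical
  induction hn : l.length generalizing l l' with
  | zero =>
    rw [List.length_eq_zero_iff] at hn
    subst hn
    rw [List.nil_perm.1 h]
    exact refl _
  | succ n ih =>
    -- Remove a vertex with at most one neighbour among the letters, bring it to the front of both
    -- words by rotation, and apply induction to the rest.
    obtain ⟨v, hv, u, hu⟩ := hforest l.toFinset (by
      rw [List.toFinset_nonempty_iff]; rintro rfl; simp at hn)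
    rw [List.mem_toFinset] at hv
    obtain ⟨p, q, rfl⟩ := List.append_of_mem hv
    obtain ⟨p', q', rfl⟩ := List.append_of_mem (h.mem_iff.1 hv)
    have h1 : (v :: (q ++ p)).Perm (v :: (q' ++ p')) :=
      (List.perm_append_comm.symm.trans h).trans List.perm_append_comm
    have h2 : (v :: (q ++ p)).Nodup := (List.perm_append_comm.nodup_iff).1 hl
    have h3 : (q ++ p).Nodup := (List.nodup_cons.1 h2).2
    have h4 := ih h3 (List.perm_cons v |>.1 h1) (by
      simp only [List.length_append, List.length_cons] at hn ⊢; omega)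
    refine ((append_comm p (v :: q)).trans (h4.cons (u := u) h3 fun y hy => hu y ?_)).trans
      (append_comm (v :: q') p')
    simp only [List.mem_append, List.mem_toFinset, List.mem_cons] at hy ⊢
    tauto

end RotSwap

end Conjugacy

/-! ### Recognizing a cycle. -/

section Cycle

variable {I : Type*} [Finite I] {adj : I → I → Prop}

/-- A finite graph in which every vertex has exactly two neighbours, and in which no proper
nonempty set of vertices has the same property, is a cycle. -/
theorem exists_cycle (hsymm : ∀ i j, adj i j → adj j i) (hirr : ∀ i, ¬ adj i i)
    (hnb : ∀ i, ∃ y z, y ≠ z ∧ ∀ j, adj i j ↔ j = y ∨ j = z)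
    (hconn : ∀ S : Set I, S.Nonempty → (∀ v ∈ S, ∃ y ∈ S, ∃ z ∈ S, y ≠ z ∧ adj v y ∧ adj v z) →
      S = Set.univ) (o : I) :
    ∃ (m : ℕ) (f : ℕ → I), f 0 = o ∧ 0 < m ∧ (∀ k < m, ∀ l < m, f k = f l → k = l) ∧
      (∀ x, ∃ k < m, f k = x) ∧
      ∀ k l, 0 < k → k < m → 0 < l → l < m → (adj (f k) (f l) ↔ l = k + 1 ∨ k = l + 1) := by
  -- A walk without backtracking: arriving at c from p, go on to the other neighbour. The value p
  -- for nonadjacent pairs is a dummy.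
  have hnext : ∀ p c, ∃ q, adj p c → adj c q ∧ q ≠ p ∧ ∀ r, adj c r → r = p ∨ r = q := by
    intro p c
    by_cases hpc : adj p c
    · obtain ⟨y, z, hyz, h⟩ := hnb c
      rcases (h p).1 (hsymm _ _ hpc) with rfl | rfl
      · exact ⟨z, fun _ => ⟨(h z).2 (Or.inr rfl), hyz.symm, fun r hr => (h r).1 hr⟩⟩
      · exact ⟨y, fun _ => ⟨(h y).2 (Or.inl rfl), hyz, fun r hr => ((h r).1 hr).symm⟩⟩
    · exact ⟨p, fun h => absurd h hpc⟩
  choose next hnext using hnext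
  obtain ⟨y, _, -, hy⟩ := hnb o
  let g : ℕ → I × I := fun k => Nat.rec (o, y) (fun _ a => (a.2, next a.1 a.2)) k
  let f : ℕ → I := fun k => (g k).1
  have hadj : ∀ k, adj (f k) (f (k + 1)) := by
    intro k
    induction k with
    | zero => exact (hy y).2 (Or.inl rfl)
    | succ k ih => exact (hnext _ _ ih).1
  have hne : ∀ k, f (k + 2) ≠ f k := fun k => (hnext _ _ (hadj k)).2.1
  have hor : ∀ k r, adj (f (k + 1)) r → r = f k ∨ r = f (k + 2) := fun k =>
    (hnext _ _ (hadj k)).2.2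
  have hex : ∃ m, ∃ j < m, f j = f m := by
    obtain ⟨a, b, hab, h⟩ := Finite.exists_ne_map_eq_of_infinite f
    rcases lt_or_gt_of_ne hab with h1 | h1
    · exact ⟨b, a, h1, h⟩
    · exact ⟨a, b, h1, h.symm⟩
  classical
  set m := Nat.find hex with hm
  have hinj' : ∀ k l, k < l → l < m → f k ≠ f l := fun k l hkl hl h =>
    Nat.find_min hex hl ⟨k, hkl, h⟩
  have hinj : ∀ k < m, ∀ l < m, f k = f l → k = l := by
    intro k hk l hl h
    rcases lt_trichotomy k l with h1 | h1 | h1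
    · exact absurd h (hinj' k l h1 hl)
    · exact h1
    · exact absurd h.symm (hinj' l k h1 hk)
  obtain ⟨j, hj, hjm⟩ := Nat.find_spec hex
  rw [← hm] at hj hjm
  have hpred : adj (f m) (f (m - 1)) := by
    have := hadj (m - 1)
    rw [Nat.sub_add_cancel (by omega)] at this
    exact hsymm _ _ this
  have hj1 : j ≠ m - 1 := by
    rintro rfl
    rw [hjm] at hpred
    exact hirr _ hpred
  have hj2 : j ≠ m - 2 := by
    intro h
    have := hne j
    rw [h, Nat.sub_add_cancel (by omega), ← h, hjm] at this
    exact this rfl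
  -- At the first repetition f m = f j with j > 0, the vertex f (m - 1) would be f (j - 1) or f (j +
  -- 1), an earlier repetition. So the walk closes up at its start.
  obtain rfl : j = 0 := by
    by_contra h0
    obtain ⟨i, rfl⟩ := Nat.exists_eq_succ_of_ne_zero h0
    rw [← hjm] at hpred
    rcases hor i _ hpred with h | h
    · have := hinj (m - 1) (by omega) i (by omega) h
      omega
    · have := hinj (m - 1) (by omega) (i + 2) (by omega) h
      omega
  have hm3 : 3 ≤ m := by omega
  refine ⟨m, f, rfl, hj, hinj, ?_, ?_⟩
  · have huniv := hconn {x | ∃ k < m, f k = x} ⟨f 0, 0, hj, rfl⟩ (by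
      rintro _ ⟨k, hk, rfl⟩
      have hmem : ∀ k ≤ m, f k ∈ {x | ∃ k < m, f k = x} := fun k hk => by
        rcases hk.lt_or_eq with h | rfl
        · exact ⟨k, h, rfl⟩
        · exact ⟨0, hj, hjm⟩
      rcases k with _ | k
      · refine ⟨f 1, hmem 1 (by omega), f (m - 1), hmem (m - 1) (by omega), fun h => ?_, hadj 0, hjm ▸ hpred⟩
        have := hinj 1 (by omega) (m - 1) (by omega) h
        omega
      · exact ⟨f k, hmem k (by omega), f (k + 2), hmem (k + 2) (by omega), (hne k).symm,
          hsymm _ _ (hadj k), hadj (k + 1)⟩)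
    exact fun x => huniv.ge (Set.mem_univ x)
  · intro k l hk hkm hl hlm
    constructor
    · intro h
      obtain ⟨k, rfl⟩ := Nat.exists_eq_succ_of_ne_zero hk.ne'
      rcases hor k _ h with h | h
      · exact Or.inr (by rw [hinj l hlm k (by omega) h])
      · rcases (show k + 2 ≤ m from hkm).lt_or_eq with h1 | h1
        · exact Or.inl (hinj _ hlm _ h1 h)
        · rw [h1, ← hjm] at h
          have := hinj _ hlm _ hj h
          omega
    · rintro (rfl | rfl)
      · exact hadj k
      · exact hsymm _ _ (hadj l)

end Cycle

/-! ### The affine diagram and uniqueness outside type A. -/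

section Diagram

variable {ι M N : Type*} [Finite ι] [AddCommGroup M] [Module ℝ M] [AddCommGroup N] [Module ℝ N]
  {P : RootPairing ι ℝ M N} [P.IsRootSystem] [P.IsCrystallographic] [P.IsReduced]
  [P.IsIrreducible] (b : P.Base)

/-- The entries of the affine Cartan matrix. -/
noncomputable def affCartan (i j : Option b.support) : ℝ := P.toLinearMap (aroot b i) (acoroot b j)

theorem exists_int_affCartan (i j : Option b.support) : ∃ z : ℤ, affCartan b i j = z := by
  obtain ⟨k, -, -, -, hk, -⟩ := exists_affVal_eq_sval b i
  obtain ⟨l, -, -, hl, -, -⟩ := exists_affVal_eq_sval b j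
  refine ⟨P.pairingIn ℤ k l, ?_⟩
  rw [affCartan, hk, hl, P.root_coroot_eq_pairing, ← P.algebraMap_pairingIn ℤ]
  simp

theorem affCartan_nonpos {i j : Option b.support} (h : i ≠ j) : affCartan b i j ≤ 0 := by
  rcases i with _ | i <;> rcases j with _ | j
  · exact absurd rfl h
  · simpa [affCartan, aroot, acoroot] using pairing_highestRoot_nonneg b j
  · simpa [affCartan, aroot, acoroot] using pairing_nonneg_symm (pairing_highestRoot_nonneg b i)
  · simpa [affCartan, aroot, acoroot] using
      pairing_nonpos_of_ne b (fun h' => h (congrArg some h'))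

theorem affCartan_mul_rform (i j : Option b.support) :
    affCartan b i j * rform P (aroot b j) (aroot b j) = 2 * rform P (aroot b i) (aroot b j) :=
  (two_mul_rform_aroot b _ j).symm

theorem affCartan_symm_eq_zero {i j : Option b.support} (h : affCartan b i j = 0) :
    affCartan b j i = 0 := by
  have h1 := affCartan_mul_rform b i j
  have h2 := affCartan_mul_rform b j i
  rw [rform_comm (aroot b j), ← h1, h, zero_mul] at h2
  exact (mul_eq_zero.1 h2).resolve_right (rform_self_pos (aroot_ne_zero b i)).ne'

/-- Adjacency in the affine Dynkin diagram. -/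
def AffAdj (i j : Option b.support) : Prop := i ≠ j ∧ affCartan b i j ≠ 0

variable {b}

theorem AffAdj.symm {i j : Option b.support} (h : AffAdj b i j) : AffAdj b j i :=
  ⟨h.1.symm, fun h0 => h.2 (affCartan_symm_eq_zero b h0)⟩

theorem AffAdj.le_neg_one {i j : Option b.support} (h : AffAdj b i j) : affCartan b i j ≤ -1 := by
  obtain ⟨z, hz⟩ := exists_int_affCartan b i j
  have h1 := lt_of_le_of_ne (affCartan_nonpos b h.1) h.2
  rw [hz] at h1 ⊢
  have : z < 0 := by exact_mod_cast h1
  exact_mod_cast (by omega : z ≤ -1)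

variable (b)

theorem simpleRefl_mul_comm {i j : Option b.support} (h : ¬ AffAdj b i j) :
    simpleRefl b i * simpleRefl b j = simpleRefl b j * simpleRefl b i := by
  by_cases hij : i = j
  · rw [hij]
  have h0 : affCartan b i j = 0 := by
    by_contra h0
    exact h ⟨hij, h0⟩
  have h1 := affCartan_symm_eq_zero b h0
  unfold affCartan at h0 h1
  ext x
  rw [affWeyl_mul_apply, affWeyl_mul_apply]
  simp only [simpleRefl_apply, sub_eq_add_neg, ← neg_smul, sval_add, map_smul, h0, h1, smul_zero,
    add_zero]
  abel

/-- The simple affine roots, normalized to unit length. -/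
noncomputable def unitRoot (i : Option b.support) : M :=
  (√(rform P (aroot b i) (aroot b i)))⁻¹ • aroot b i

theorem sqrt_rform_pos (i : Option b.support) : 0 < √(rform P (aroot b i) (aroot b i)) :=
  Real.sqrt_pos.2 (rform_self_pos (aroot_ne_zero b i))

theorem rform_unitRoot_self (i : Option b.support) : rform P (unitRoot b i) (unitRoot b i) = 1 := by
  have h := (sqrt_rform_pos b i).ne'
  have h2 := Real.mul_self_sqrt (rform_self_pos (P := P) (aroot_ne_zero b i)).le
  simp only [unitRoot, map_smul, LinearMap.smul_apply, smul_eq_mul]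
  field_simp
  rw [sq, h2]

theorem four_mul_sq_rform_unitRoot (i j : Option b.support) :
    4 * rform P (unitRoot b i) (unitRoot b j) ^ 2 = affCartan b i j * affCartan b j i := by
  have hi := (sqrt_rform_pos b i).ne'
  have hj := (sqrt_rform_pos b j).ne'
  have h1 := affCartan_mul_rform b i j
  have h2 := affCartan_mul_rform b j i
  rw [rform_comm (aroot b j)] at h2
  simp only [unitRoot, map_smul, LinearMap.smul_apply, smul_eq_mul]
  rw [← Real.mul_self_sqrt (rform_self_pos (aroot_ne_zero b i)).le] at h2
  rw [← Real.mul_self_sqrt (rform_self_pos (aroot_ne_zero b j)).le] at h1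
  field_simp
  linear_combination -h1 * (affCartan b j i * (√(rform P (aroot b i) (aroot b i)) *
    √(rform P (aroot b i) (aroot b i)))) - h2 * (2 * rform P (aroot b i) (aroot b j))

theorem rform_unitRoot_nonpos {i j : Option b.support} (h : i ≠ j) :
    rform P (unitRoot b i) (unitRoot b j) ≤ 0 := by
  simp only [unitRoot, map_smul, LinearMap.smul_apply, smul_eq_mul]
  refine mul_nonpos_of_nonneg_of_nonpos (inv_nonneg.2 (Real.sqrt_nonneg _))
    (mul_nonpos_of_nonneg_of_nonpos (inv_nonneg.2 (Real.sqrt_nonneg _)) ?_)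
  have h1 := mul_nonpos_of_nonpos_of_nonneg (affCartan_nonpos b h)
    (rform_self_pos (P := P) (aroot_ne_zero b j)).le
  rw [affCartan_mul_rform] at h1
  linarith

variable {b} in
theorem AffAdj.rform_unitRoot_le {i j : Option b.support} (h : AffAdj b i j) :
    rform P (unitRoot b i) (unitRoot b j) ≤ -1 / 2 := by
  have h1 := four_mul_sq_rform_unitRoot b i j
  have h2 := rform_unitRoot_nonpos b h.1
  have h3 := h.le_neg_one
  have h4 := h.symm.le_neg_one
  nlinarith

/-- Applied to a row of the Gram matrix of the unit roots: two neighbours, each contributing at most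
-½, cancel the diagonal 1. -/
theorem sum_eq_of_half {I : Type*} {S : Finset I} {f : I → ℝ} {i y z : I} (hi : i ∈ S)
    (hy : y ∈ S) (hz : z ∈ S) (hyz : y ≠ z) (hiy : i ≠ y) (hiz : i ≠ z) (h1 : f i = 1)
    (h0 : ∀ j, i ≠ j → f j ≤ 0) (hfy : f y ≤ -1 / 2) (hfz : f z ≤ -1 / 2) :
    ∑ j ∈ S, f j ≤ 0 ∧ (∑ j ∈ S, f j = 0 →
      f y = -1 / 2 ∧ f z = -1 / 2 ∧ ∀ j ∈ S, i ≠ j → j ≠ y → j ≠ z → f j = 0) := by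
  classical
  have hsum : ∑ j ∈ S, f j = f i + (f y + (f z + ∑ j ∈ ((S.erase i).erase y).erase z, f j)) := by
    rw [Finset.add_sum_erase _ _ (by simp [hz, hyz.symm, hiz.symm]),
      Finset.add_sum_erase _ _ (by simp [hy, hiy.symm]), Finset.add_sum_erase _ _ hi]
  have hrest : ∀ j ∈ ((S.erase i).erase y).erase z, f j ≤ 0 := fun j hj => h0 j <| by
    simp only [Finset.mem_erase] at hj
    exact hj.2.2.1.symm
  have hle := Finset.sum_nonpos hrest
  refine ⟨by linarith, fun h => ⟨by linarith, by linarith, fun j hj h2 h3 h4 => ?_⟩⟩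
  exact (Finset.sum_eq_zero_iff_of_nonpos hrest).1 (by linarith) j (by simp [hj, h2.symm, h3, h4])

variable {b}

/-- A nonempty set of vertices of the affine diagram, each of which has two neighbours in the set,
consists of all vertices, and then each vertex has exactly two neighbours, by simple edges. -/
theorem eq_univ_of_two_neighbours {S : Finset (Option b.support)} (hS : S.Nonempty)
    (h : ∀ i ∈ S, ∃ y ∈ S, ∃ z ∈ S, y ≠ z ∧ AffAdj b i y ∧ AffAdj b i z) :
    S = Finset.univ ∧ ∀ i, ∃ y z, y ≠ z ∧ (∀ j, AffAdj b i j ↔ j = y ∨ j = z) ∧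
      affCartan b i y * affCartan b y i = 1 ∧ affCartan b i z * affCartan b z i = 1 := by
  classical
  have key : ∀ i ∈ S, ∑ j ∈ S, rform P (unitRoot b i) (unitRoot b j) ≤ 0 := fun i hi => by
    obtain ⟨y, hy, z, hz, hyz, hiy, hiz⟩ := h i hi
    exact (sum_eq_of_half hi hy hz hyz hiy.1 hiz.1 (rform_unitRoot_self b i)
      (fun j hj => rform_unitRoot_nonpos b hj) hiy.rform_unitRoot_le hiz.rform_unitRoot_le).1
  have hzero : ∑ j ∈ S, unitRoot b j = 0 := by
    by_contra hne
    refine (rform_self_pos (P := P) hne).not_ge ?_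
    rw [map_sum]
    exact Finset.sum_nonpos fun i hi => by rw [rform_comm, map_sum]; exact key i hi
  -- The vanishing sum is a linear relation between simple affine roots, hence a multiple of the
  -- marks, all of which are nonzero.
  have huniv : S = Finset.univ := by
    have h1 : ∑ i, (if i ∈ S then (√(rform P (aroot b i) (aroot b i)))⁻¹ else 0) • aroot b i = 0 := by
      simpa [ite_smul, Finset.sum_ite_mem, unitRoot] using hzero
    have h2 := eq_mul_marks_of_sum_eq_zero b h1
    obtain ⟨k, hk⟩ := hS
    have h3 := h2 k
    rw [if_pos hk] at h3
    refine Finset.eq_univ_iff_forall.2 fun i => ?_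
    by_contra hi
    have h4 := h2 i
    rw [if_neg hi, eq_comm, mul_eq_zero, or_iff_left (marks_pos b i).ne'] at h4
    rw [h4, zero_mul] at h3
    exact inv_ne_zero (sqrt_rform_pos b k).ne' h3
  refine ⟨huniv, fun i => ?_⟩
  have hmem : ∀ j, j ∈ S := fun j => huniv ▸ Finset.mem_univ j
  obtain ⟨y, hy, z, hz, hyz, hiy, hiz⟩ := h i (hmem i)
  obtain ⟨h1, h2, h3⟩ := (sum_eq_of_half (hmem i) hy hz hyz hiy.1 hiz.1 (rform_unitRoot_self b i)
      (fun j hj => rform_unitRoot_nonpos b hj) hiy.rform_unitRoot_le hiz.rform_unitRoot_le).2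
      (by rw [← map_sum, hzero, map_zero])
  refine ⟨y, z, hyz, fun j => ⟨fun hj => ?_, ?_⟩, ?_, ?_⟩
  · by_contra! hne
    have := hj.rform_unitRoot_le
    rw [h3 j (hmem j) hj.1 hne.1 hne.2] at this
    norm_num at this
  · rintro (rfl | rfl)
    · exact hiy
    · exact hiz
  · rw [← four_mul_sq_rform_unitRoot, h1]; norm_num
  · rw [← four_mul_sq_rform_unitRoot, h2]; norm_num

theorem affCartan_some (i j : b.support) :
    affCartan b (some i) (some j) = b.cartanMatrix i j := by
  rw [affCartan, aroot, acoroot, P.root_coroot_eq_pairing, ← P.algebraMap_pairingIn ℤ,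
    RootPairing.Base.cartanMatrix, RootPairing.Base.cartanMatrixIn_def]
  simp

/-- A set with no vertex of degree at most one would make the affine diagram a simply laced cycle;
removing the affine node leaves a path, which is type A. -/
theorem forest_of_not_isTypeA (hA : ¬ IsTypeA b) (S : Finset (Option b.support))
    (hS : S.Nonempty) : ∃ v ∈ S, ∃ u, ∀ y ∈ S, AffAdj b v y → y = u := by
  classical
  by_contra! hnot
  have htwo : ∀ i ∈ S, ∃ y ∈ S, ∃ z ∈ S, y ≠ z ∧ AffAdj b i y ∧ AffAdj b i z := fun i hi => by
    obtain ⟨y, hy, hiy, -⟩ := hnot i hi i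
    obtain ⟨z, hz, hiz, hzy⟩ := hnot i hi y
    exact ⟨y, hy, z, hz, hzy.symm, hiy, hiz⟩
  have hnb := (eq_univ_of_two_neighbours hS htwo).2
  have hone : ∀ i j, AffAdj b i j → affCartan b i j = -1 := fun i j hij => by
    obtain ⟨y, z, -, hor, hy, hz⟩ := hnb i
    have h1 : affCartan b i j * affCartan b j i = 1 := by
      rcases (hor j).1 hij with rfl | rfl
      · exact hy
      · exact hz
    have h2 := hij.le_neg_one
    have h3 := hij.symm.le_neg_one
    nlinarith
  obtain ⟨m, f, hf0, hm, hinj, hsurj, hadj⟩ := exists_cycle (adj := AffAdj b)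
    (fun _ _ h => h.symm) (fun _ h => h.1 rfl)
    (fun i => by obtain ⟨y, z, h1, h2, -⟩ := hnb i; exact ⟨y, z, h1, h2⟩)
    (fun S hS h => by
      have := (eq_univ_of_two_neighbours (S := S.toFinset) (by simpa using hS)
        (by simpa using h)).1
      rw [← Set.coe_toFinset S, this, Finset.coe_univ]) none
  have hg : ∀ k : Fin (m - 1), ∃ i : b.support, some i = f (k + 1) := fun k => by
    have : f (k + 1) ≠ none := fun h => by
      have := hinj (k + 1) (by omega) 0 hm (h.trans hf0.symm)
      omega
    obtain ⟨i, hi⟩ := Option.ne_none_iff_exists.1 this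
    exact ⟨i, hi⟩
  choose g hg using hg
  have hbij : Function.Bijective g := by
    constructor
    · intro k l hkl
      have := hinj (k + 1) (by omega) (l + 1) (by omega) (by rw [← hg, ← hg, hkl])
      exact Fin.ext (by omega)
    · intro i
      obtain ⟨k, hk, hki⟩ := hsurj (some i)
      rcases k with _ | k
      · rw [hf0] at hki
        exact absurd hki (by simp)
      · exact ⟨⟨k, by omega⟩, Option.some_injective _ ((hg _).trans hki)⟩
  refine hA ⟨m - 1, (Equiv.ofBijective g hbij).symm, fun i j => ?_⟩
  obtain ⟨k, rfl⟩ := hbij.2 i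
  obtain ⟨l, rfl⟩ := hbij.2 j
  have hsymm : ∀ k, (Equiv.ofBijective g hbij).symm (g k) = k := fun k =>
    (Equiv.ofBijective g hbij).symm_apply_apply k
  rw [hsymm, hsymm, ← Int.cast_inj (α := ℝ), ← affCartan_some, hg, hg]
  have h2 := hadj (k + 1) (l + 1) (by omega) (by omega) (by omega) (by omega)
  simp only [CartanMatrix.A, Matrix.of_apply]
  split_ifs with h3 h4
  · rw [h3, affCartan, aroot_acoroot_self]; norm_num
  · rw [hone _ _ (h2.2 (by omega))]; norm_num
  · by_contra h5
    have hne : f (k + 1) ≠ f (l + 1) := fun h => h3 <| Fin.ext <| by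
      have := hinj (k + 1) (by omega) (l + 1) (by omega) h
      omega
    have := h2.1 ⟨hne, by simpa using h5⟩
    omega

/-- If the affine diagram is a forest, all Coxeter elements are conjugate. -/
theorem isConj_of_not_isTypeA (hA : ¬ IsTypeA b) {c c' : affWeyl P}
    (hc : IsCoxeterElement (simpleRefl b) c) (hc' : IsCoxeterElement (simpleRefl b) c') :
    IsConj c c' := by
  classical
  obtain ⟨l, hl, hall, rfl⟩ := hc
  obtain ⟨l', hl', hall', rfl⟩ := hc'
  refine (RotSwap.of_perm (forest_of_not_isTypeA hA) hl
    ((List.perm_ext_iff_of_nodup hl hl').2 fun i => iff_of_true (hall i) (hall' i))).isConj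
    fun i j h => simpleRefl_mul_comm b h

theorem IsTransl.conj {t : affWeyl P} {v : N} (h : IsTransl t v) (g : affWeyl P) :
    IsTransl (g * t * g⁻¹) (g.1.linear v) := fun x => by
  rw [affWeyl_mul_apply, affWeyl_mul_apply, h, affineEquiv_apply_add, ← affWeyl_mul_apply,
    mul_inv_cancel]
  rfl

theorem neg_iff_of_reflSet_eq {v w : N}
    (h : (reflSet (rayRoots b v) : Set (affWeyl P)) = reflSet (rayRoots b w)) (j : ι) :
    P.toLinearMap (P.root j) v < 0 ↔ P.toLinearMap (P.root j) w < 0 :=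
  ⟨(reflSet_rayRoots_subset_iff b).1 h.le j, (reflSet_rayRoots_subset_iff b).1 h.ge j⟩

theorem neg_apply_iff {w : N ≃ₗ[ℝ] N} (hw : w ∈ finWeyl P) {u v : N}
    (h : ∀ j, P.toLinearMap (P.root j) u < 0 ↔ P.toLinearMap (P.root j) v < 0) (j : ι) :
    P.toLinearMap (P.root j) (w u) < 0 ↔ P.toLinearMap (P.root j) (w v) < 0 := by
  obtain ⟨k, -, hk⟩ := exists_coroot_eq_of_mem_finWeyl ((finWeyl P).inv_mem hw) j
  have hcancel : ∀ x, w⁻¹ (w x) = x := fun x => w.symm_apply_apply x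
  rw [← hk, ← hk, hcancel, hcancel]
  exact h k

theorem eq_of_isCoxeterNode (hA : ¬ IsTypeA b) {i i' : b.support} (hi : IsCoxeterNode b i)
    (hi' : IsCoxeterNode b i') : i = i' := by
  classical
  obtain ⟨w, hw, c, x, hc, hx, hxi⟩ := (isCoxeterNode_iff i).1 hi
  obtain ⟨w', hw', c', x', hc', hx', hxi'⟩ := (isCoxeterNode_iff i').1 hi'
  obtain ⟨g, rfl⟩ := isConj_iff.1 (isConj_of_not_isTypeA hA hc hc')
  obtain ⟨m, hm, v, hv⟩ := exists_pow_isTransl c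
  rw [hx.inv_eq b hm hv] at hxi
  rw [hx'.inv_eq b hm (by rw [conj_pow]; exact hv.conj g)] at hxi'
  have hg := linear_mem_finWeyl g.2
  have hw'' := (finWeyl P).inv_mem hw'
  have h1 := neg_apply_iff hw'' fun j => (neg_iff_of_reflSet_eq hxi' j).symm.trans
    (neg_apply_iff hg (neg_iff_of_reflSet_eq hxi) j)
  have hcancel : w'⁻¹ (w' (fundCoweight b i')) = fundCoweight b i' := w'.symm_apply_apply _
  rw [hcancel] at h1
  set u := w'⁻¹ * g.1.linear * w with hu
  -- Only sign patterns are known to agree. They suffice to make uωᵢ^∨ dominant, like ωᵢ'^∨, so it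
  -- equals ωᵢ^∨; testing the signs on -αᵢ then gives i = i'.
  have hfix : u (fundCoweight b i) = fundCoweight b i := by
    refine apply_eq_self_of_isDominant b (mul_mem (mul_mem hw'' hg) hw) (fun k => ?_) fun k => ?_
    · rw [root_fundCoweight]; split_ifs <;> norm_num
    · refine not_lt.1 fun h => ?_
      have := (h1 k).2 h
      rw [root_fundCoweight] at this
      split_ifs at this <;> norm_num at this
  have h2 : ∀ j, P.toLinearMap (P.root j) (fundCoweight b i') < 0 ↔
      P.toLinearMap (P.root j) (fundCoweight b i) < 0 := fun j => by
    rw [h1 j]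
    exact iff_of_eq (congrArg (fun y => P.toLinearMap (P.root j) y < 0) hfix)
  have h3 := h2 (P.reflectionPerm i i)
  simp only [P.root_reflectionPerm, P.reflection_apply_self, map_neg, LinearMap.neg_apply,
    root_fundCoweight] at h3
  by_contra hne
  simp [hne] at h3

end Diagram

/-! ### Sums over the Cartan matrix of type A. -/

section CartanA

theorem cartanA_eq (n : ℕ) (i j : Fin n) : CartanMatrix.A n i j =
    (if (j : ℕ) = i then 2 else 0) - (if (j : ℕ) = i + 1 then 1 else 0) -
      (if 0 < (i : ℕ) ∧ (j : ℕ) = i - 1 then 1 else 0) := by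
  simp only [CartanMatrix.A, Matrix.of_apply, Fin.ext_iff]
  split_ifs <;> omega

theorem sum_cartanA (n : ℕ) (i : Fin n) : ∑ j, CartanMatrix.A n i j =
    (if (i : ℕ) = 0 then 1 else 0) + (if (i : ℕ) = n - 1 then 1 else 0) := by
  simp only [cartanA_eq, Finset.sum_sub_distrib]
  have h1 : (∑ j : Fin n, if (j : ℕ) = i then (2 : ℤ) else 0) = 2 := by
    rw [Fin.sum_univ_eq_sum_range (fun j => if j = (i : ℕ) then (2 : ℤ) else 0)]
    simp
  have h2 : (∑ j : Fin n, if (j : ℕ) = i + 1 then (1 : ℤ) else 0) =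
      if (i : ℕ) + 1 < n then 1 else 0 := by
    rw [Fin.sum_univ_eq_sum_range (fun j => if j = (i : ℕ) + 1 then (1 : ℤ) else 0)]
    simp
  have h3 : (∑ j : Fin n, if 0 < (i : ℕ) ∧ (j : ℕ) = i - 1 then (1 : ℤ) else 0) =
      if 0 < (i : ℕ) then 1 else 0 := by
    rw [Fin.sum_univ_eq_sum_range (fun j => if 0 < (i : ℕ) ∧ j = (i : ℕ) - 1 then (1 : ℤ) else 0)]
    by_cases h : 0 < (i : ℕ)
    · simp [h, show (i : ℕ) - 1 < n by omega]
    · simp [h]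
  rw [h1, h2, h3]
  have := i.2
  split_ifs <;> omega

theorem sum_sum_cartanA {n : ℕ} (hn : 0 < n) : ∑ i, ∑ j, CartanMatrix.A n i j = 2 := by
  simp only [sum_cartanA, Finset.sum_add_distrib]
  rw [Fin.sum_univ_eq_sum_range (fun i => if i = 0 then (1 : ℤ) else 0),
    Fin.sum_univ_eq_sum_range (fun i => if i = n - 1 then (1 : ℤ) else 0)]
  simp [hn]

/-- An ordering of `0, …, n - 1` in which `p` comes last, the vertices before `p` ascend, and the
vertices after `p` descend. -/
def peakKey (n p t : ℕ) : ℕ := if t < p then t else if p < t then 2 * n - t else 3 * n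

theorem peakKey_inj {n p t u : ℕ} (ht : t < n) (hu : u < n)
    (h : peakKey n p t = peakKey n p u) : t = u := by
  unfold peakKey at h
  split_ifs at h <;> omega

/-- Every vertex t ≠ p has exactly one neighbour later in the order, the next one towards p, with
Cartan entry -1. -/
theorem sum_cartanA_peakKey {n : ℕ} (p t : Fin n) :
    (∑ j : Fin n, if peakKey n p t < peakKey n p j then CartanMatrix.A n t j else 0) =
      if t = p then 0 else -1 := by
  have hp := p.2
  have ht := t.2
  have key : ∀ j : Fin n, (if peakKey n p t < peakKey n p j then CartanMatrix.A n t j else 0) =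
      if t ≠ p ∧ (j : ℕ) = (if (t : ℕ) < p then t + 1 else t - 1 : ℕ) then -1 else 0 := by
    intro j
    have hj := j.2
    rw [cartanA_eq]
    simp only [peakKey, Fin.ext_iff, ne_eq]
    split_ifs <;> omega
  rw [Finset.sum_congr rfl fun j _ => key j, Fin.sum_univ_eq_sum_range
    (fun j => if t ≠ p ∧ j = (if (t : ℕ) < p then t + 1 else t - 1 : ℕ) then (-1 : ℤ) else 0)]
  by_cases h : t = p
  · simp [h]
  · have h1 : (if (t : ℕ) < p then t + 1 else t - 1 : ℕ) < n := by split_ifs <;> omega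
    simp only [ne_eq, h, not_false_eq_true, true_and, Finset.sum_ite_eq', Finset.mem_range, h1,
      if_true, if_false]

end CartanA

/-! ### Type A: every node is a Coxeter node. -/

section TypeA

variable {ι M N : Type*} [Finite ι] [AddCommGroup M] [Module ℝ M] [AddCommGroup N] [Module ℝ N]
  {P : RootPairing ι ℝ M N} [P.IsRootSystem] [P.IsCrystallographic] [P.IsReduced]
  [P.IsIrreducible] {b : P.Base}

theorem rform_root_eq {K : ℝ} (h : ∀ i : b.support, rform P (P.root i) (P.root i) = K) (j : ι) :
    rform P (P.root j) (P.root j) = K := by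
  let := Fintype.ofFinite ι
  have hinv : ∀ i j, rform P (P.root (P.reflectionPerm i j)) (P.root (P.reflectionPerm i j)) =
      rform P (P.root j) (P.root j) := fun i j => by
    rw [P.root_reflectionPerm]
    exact P.rootForm_reflection_reflection_apply i _ _
  exact b.induction_reflect (p := fun j => rform P (P.root j) (P.root j) = K) j
    (fun i hi => (hinv i i).trans hi) (fun i hi => h ⟨i, hi⟩) fun i j hi _ => (hinv j i).trans hi

variable {n : ℕ} {e : b.support ≃ Fin n}

theorem affCartan_eq_cartanA
    (he : ∀ i j, b.cartanMatrix i j = CartanMatrix.A n (e i) (e j))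
    (i j : b.support) :
    affCartan b (some i) (some j) = CartanMatrix.A n (e i) (e j) := by
  rw [affCartan_some, he]

theorem exists_rform_simple_eq
    (he : ∀ i j, b.cartanMatrix i j = CartanMatrix.A n (e i) (e j)) : ∃ K : ℝ, ∀ i : b.support, rform P (P.root i) (P.root i) = K := by
  obtain ⟨o⟩ := support_nonempty b
  have hn : 0 < n := (e o).pos
  refine ⟨rform P (P.root (e.symm ⟨0, hn⟩)) (P.root (e.symm ⟨0, hn⟩)), ?_⟩
  have key : ∀ k (hk : k < n), rform P (P.root (e.symm ⟨k, hk⟩)) (P.root (e.symm ⟨k, hk⟩)) =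
      rform P (P.root (e.symm ⟨0, hn⟩)) (P.root (e.symm ⟨0, hn⟩)) := by
    intro k hk
    induction k with
    | zero => rfl
    | succ k ih =>
      rw [← ih (by omega)]
      have h1 := affCartan_mul_rform b (some (e.symm ⟨k + 1, hk⟩)) (some (e.symm ⟨k, by omega⟩))
      have h2 := affCartan_mul_rform b (some (e.symm ⟨k, by omega⟩)) (some (e.symm ⟨k + 1, hk⟩))
      rw [rform_comm (aroot b (some (e.symm ⟨k, _⟩))), ← h1, affCartan_eq_cartanA he, affCartan_eq_cartanA he, cartanA_eq,
        cartanA_eq] at h2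
      simp only [Equiv.apply_symm_apply, aroot] at h2
      simpa [show k + 1 ≠ k - 1 by omega, show k ≠ k + 1 + 1 by omega] using h2
  intro i
  simpa using key (e i) (e i).2

/-- Let β be the sum of the simple roots and K the common squared length of the roots. Then |β|² =
K, and (ξ, β) ≥ K since the marks are at least 1 and the row sums of the Cartan matrix are
nonnegative. So |ξ - β|² ≤ 0. -/
theorem highestRoot_eq_sum
    (he : ∀ i j, b.cartanMatrix i j = CartanMatrix.A n (e i) (e j)) : P.root (highestRoot b) = ∑ i : b.support, P.root i := by
  obtain ⟨K, hK⟩ := exists_rform_simple_eq he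
  obtain ⟨o⟩ := support_nonempty b
  have hn : 0 < n := (e o).pos
  have hK0 : 0 < K := hK o ▸ rform_self_pos (P := P) (P.ne_zero o)
  have hrow : ∀ i : b.support, ∑ j : b.support, 2 * rform P (P.root i) (P.root j) =
      K * (∑ j, CartanMatrix.A n (e i) j : ℤ) := fun i => by
    rw [← e.sum_comp, Int.cast_sum, Finset.mul_sum]
    refine Finset.sum_congr rfl fun j _ => ?_
    have := affCartan_mul_rform b (some i) (some j)
    rw [affCartan_eq_cartanA he] at this
    simp only [aroot, hK] at this
    rw [← this, mul_comm]
  have hm : ∀ i : b.support, 1 ≤ P.toLinearMap (P.root (highestRoot b)) (fundCoweight b i) :=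
    fun i => by
    obtain ⟨f, hf, -⟩ := exists_int_coords b (highestRoot b)
    have h := coords_highestRoot_pos b i
    rw [hf] at h ⊢
    exact_mod_cast h
  have hr0 : ∀ i : b.support, (0 : ℝ) ≤ (∑ j, CartanMatrix.A n (e i) j : ℤ) := fun i => by
    rw [sum_cartanA]
    split_ifs <;> simp
  have hr2 : ∑ i : b.support, ((∑ j, CartanMatrix.A n (e i) j : ℤ) : ℝ) = 2 := by
    rw [← Int.cast_sum, e.sum_comp fun i => ∑ j, CartanMatrix.A n i j, sum_sum_cartanA hn]
    norm_num
  set β := ∑ i : b.support, P.root i with hβ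
  have hββ : 2 * rform P β β = 2 * K := by
    have : ∑ i : b.support, ∑ j : b.support, 2 * rform P (P.root i) (P.root j) = 2 * K := by
      rw [Finset.sum_congr rfl fun i _ => hrow i, ← Finset.mul_sum, hr2, mul_comm]
    rw [← this, hβ]
    simp only [map_sum, LinearMap.sum_apply, Finset.mul_sum]
    exact Finset.sum_comm
  have hξβ : 2 * K ≤ 2 * rform P (P.root (highestRoot b)) β := by
    have h1 : 2 * rform P (P.root (highestRoot b)) β =
        ∑ i : b.support, P.toLinearMap (P.root (highestRoot b)) (fundCoweight b i) *
          (K * (∑ j, CartanMatrix.A n (e i) j : ℤ)) := by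
      conv_lhs => rw [← sum_fundCoweight_smul_root b (P.root (highestRoot b))]
      simp only [← hrow]
      rw [rform_comm]
      simp only [hβ, map_sum, map_smul, LinearMap.sum_apply, smul_eq_mul, Finset.mul_sum]
      refine Finset.sum_congr rfl fun i _ => Finset.sum_congr rfl fun j _ => ?_
      rw [rform_comm]
      ring
    rw [h1, ← hr2, Finset.sum_mul]
    refine Finset.sum_le_sum fun i _ => ?_
    have := mul_le_mul_of_nonneg_right (hm i) (mul_nonneg hK0.le (hr0 i))
    linarith
  have hξξ := rform_root_eq hK (highestRoot b)
  rw [← sub_eq_zero]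
  by_contra hne
  have hpos := rform_self_pos (P := P) hne
  simp only [map_sub, LinearMap.sub_apply, rform_comm β] at hpos
  linarith

theorem exists_comarks_eq
    (he : ∀ i j, b.cartanMatrix i j = CartanMatrix.A n (e i) (e j)) : ∃ K : ℝ, 0 < K ∧ ∀ i, comarks b i = K := by
  classical
  obtain ⟨K, hK⟩ := exists_rform_simple_eq he
  have hone : ∀ i, marks b i = 1 := fun i => by
    rcases i with _ | i
    · rfl
    · simp [marks, highestRoot_eq_sum he, root_fundCoweight]
  have hall : ∀ i, comarks b i = K / 2 := fun i => by
    obtain ⟨j, -, -, -, hj, -⟩ := exists_affVal_eq_sval b i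
    rw [comarks, hone, one_mul, hj, rform_root_eq hK]
  exact ⟨K / 2, hall none ▸ comarks_pos b none, hall⟩

theorem acoroot_none_eq_neg_sum
    (he : ∀ i j, b.cartanMatrix i j = CartanMatrix.A n (e i) (e j)) : acoroot b none = -∑ i : b.support, P.coroot i := by
  obtain ⟨K, hK, h⟩ := exists_comarks_eq he
  have h1 := sum_comarks_smul_acoroot b
  simp only [h, ← Finset.smul_sum] at h1
  rw [smul_eq_zero_iff_right hK.ne', Fintype.sum_option] at h1
  exact eq_neg_of_add_eq_zero_left h1

/-- With all values -1, each step adds a coroot, so the current vector is ωᵢ^∨ minus the coroots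
still to come. Its pairing with αₖ is 1 - 2 for k = i, and 0 - 2 + 1 otherwise, thanks to the unique
later neighbour. -/
theorem chain_of_pairwise_peakKey
    (he : ∀ i j, b.cartanMatrix i j = CartanMatrix.A n (e i) (e j))
    (i : b.support) {L : List b.support}
    (hL : L.Pairwise fun j k => peakKey n (e i) (e j) < peakKey n (e i) (e k))
    (hup : ∀ k ∈ L, ∀ j, peakKey n (e i) (e k) < peakKey n (e i) (e j) → j ∈ L) :
    Chain b (fun _ => -1) (L.map some) (fundCoweight b i - (L.map fun j : b.support => P.coroot j).sum) := by
  classical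
  induction L with
  | nil => trivial
  | cons k L ih =>
    obtain ⟨hk, hL⟩ := List.pairwise_cons.1 hL
    have hmem : ∀ j, j ∈ L ↔ peakKey n (e i) (e k) < peakKey n (e i) (e j) := fun j =>
      ⟨hk j, fun h => (List.mem_cons.1 (hup k (by simp) j h)).resolve_left fun hjk => by
        rw [hjk] at h; exact lt_irrefl _ h⟩
    have hnodup : L.Nodup := hL.imp fun h => by rintro rfl; exact lt_irrefl _ h
    have hsum : P.toLinearMap (P.root k) (L.map fun j : b.support => P.coroot j).sum =
        if k = i then 0 else -1 := by
      have h1 : (L.map fun j : b.support => P.coroot j).sum =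
          ∑ j : b.support, if peakKey n (e i) (e k) < peakKey n (e i) (e j) then P.coroot j else 0 := by
        rw [← List.sum_toFinset _ hnodup, ← Finset.sum_filter]
        congr 1
        ext j
        simp [hmem]
      have h2 : P.toLinearMap (P.root k) (L.map fun j : b.support => P.coroot j).sum =
          (∑ j : b.support, if peakKey n (e i) (e k) < peakKey n (e i) (e j) then
            CartanMatrix.A n (e k) (e j) else 0 : ℤ) := by
        rw [h1, map_sum, Int.cast_sum]
        refine Finset.sum_congr rfl fun j _ => ?_
        split_ifs
        · exact affCartan_eq_cartanA he k j
        · simp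
      rw [h2, e.sum_comp fun j => if peakKey n (e i) (e k) < peakKey n (e i) j then
        CartanMatrix.A n (e k) j else 0, sum_cartanA_peakKey]
      simp only [e.injective.eq_iff]
      split_ifs <;> simp
    refine ⟨?_, ?_⟩
    · rw [List.map_cons, List.sum_cons, map_sub, map_add, aroot, root_fundCoweight, hsum]
      simp only [RootPairing.root_coroot_two]
      split_ifs <;> norm_num
    · have hs : fundCoweight b i - ((k :: L).map fun j : b.support => P.coroot j).sum - (-1 : ℝ) • acoroot b
          (some k) = fundCoweight b i - (L.map fun j : b.support => P.coroot j).sum := by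
        rw [List.map_cons, List.sum_cons, acoroot]
        module
      rw [hs]
      refine ih hL fun l hl j hj => (List.mem_cons.1 (hup l (by simp [hl]) j hj)).resolve_left ?_
      rintro rfl
      exact lt_asymm hj (hk l hl)

/-- The witness is s₀ followed by the other reflections in the order of `peakKey` with peak i; its
direction is ωᵢ^∨ itself, so w = 1. -/
theorem isCoxeterNode_of_cartanA
    (he : ∀ i j, b.cartanMatrix i j = CartanMatrix.A n (e i) (e j))
    (i : b.support) : IsCoxeterNode b i := by
  classical
  let κ : b.support → ℕ := fun j => peakKey n (e i) (e j)
  have hκ : Function.Injective κ := fun j k h =>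
    e.injective (Fin.ext (peakKey_inj (e j).2 (e k).2 h))
  let L := (Finset.univ : Finset b.support).toList.insertionSort fun j k => κ j ≤ κ k
  have hperm : L.Perm Finset.univ.toList := List.perm_insertionSort _ _
  have hnodup : L.Nodup := hperm.nodup_iff.2 (Finset.nodup_toList _)
  have hmem : ∀ j, j ∈ L := fun j => hperm.mem_iff.2 (by simp)
  have hpair : L.Pairwise fun j k => κ j < κ k := by
    have : Std.Total fun j k => κ j ≤ κ k := ⟨fun j k => le_total _ _⟩
    have : IsTrans b.support fun j k => κ j ≤ κ k := ⟨fun _ _ _ h h' => le_trans h h'⟩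
    refine ((List.pairwise_insertionSort (fun j k => κ j ≤ κ k) _).and hnodup).imp
      fun h => lt_of_le_of_ne h.1 fun h' => h.2 (hκ h')
  have hsum : (L.map fun j : b.support => P.coroot j).sum = ∑ j : b.support, P.coroot j :=
    sum_map_eq_sum_univ hnodup hmem _
  have hchain : Chain b (fun _ => -1) (none :: L.map some) (fundCoweight b i) := by
    refine ⟨?_, ?_⟩
    · simp [aroot, highestRoot_eq_sum he, root_fundCoweight]
    · rw [acoroot_none_eq_neg_sum he, neg_smul, one_smul, neg_neg, ← hsum]
      exact chain_of_pairwise_peakKey he i hpair fun _ _ j _ => hmem j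
  obtain ⟨K, hK, hcomarks⟩ := exists_comarks_eq he
  have hchain' : Chain b (fun i => -comarks b i) (none :: L.map some) (K • fundCoweight b i) := by
    -- Subtracting 1 - K times the chain from itself rescales it by K, the common comark.
    have h := hchain.sub_smul hchain (1 - K)
    rw [show fundCoweight b i - (1 - K) • fundCoweight b i = K • fundCoweight b i by module] at h
    exact h.congr fun j _ => by rw [hcomarks]; ring
  have hl : (none :: L.map some).Nodup := by
    simp [List.nodup_map_iff (Option.some_injective _), hnodup]
  have hall : ∀ j, j ∈ none :: L.map some := fun j => by rcases j with _ | j <;> simp [hmem]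
  obtain ⟨x, hx, hxinv⟩ := exists_isInfPower_coxeter hl hall hchain'
  rw [rayRoots_smul hK] at hxinv
  exact (isCoxeterNode_iff i).2 ⟨1, one_mem _, _, x, ⟨_, hl, hall, rfl⟩, hx, hxinv⟩

end TypeA

end LimitWeak

theorem mainTheorem2 {ι M N : Type*} [Finite ι]
    [AddCommGroup M] [Module ℝ M] [AddCommGroup N] [Module ℝ N]
    (P : RootPairing ι ℝ M N) [P.IsRootSystem] [P.IsCrystallographic] [P.IsReduced]
    [P.IsIrreducible] (b : P.Base) :
    (∃ i, LimitWeak.IsCoxeterNode b i) ∧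
    (¬ LimitWeak.IsTypeA b → ∃! i, LimitWeak.IsCoxeterNode b i) ∧
    (LimitWeak.IsTypeA b → ∀ i, LimitWeak.IsCoxeterNode b i) ∧
    (∀ c : LimitWeak.affWeyl P, LimitWeak.IsCoxeterElement (LimitWeak.simpleRefl b) c →
      ∃ x : LimitWeak.LimitElement (LimitWeak.simpleRefl b),
        (∀ y, LimitWeak.IsInfPower (LimitWeak.simpleRefl b) c y ↔ y = x) ∧ IsMin x) := by
  refine ⟨LimitWeak.exists_isCoxeterNode, fun hA => ?_, ?_, fun c hc => hc.exists_isMin⟩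
  · obtain ⟨i, hi⟩ := LimitWeak.exists_isCoxeterNode (b := b)
    exact ⟨i, hi, fun i' hi' => LimitWeak.eq_of_isCoxeterNode hA hi' hi⟩
  · rintro ⟨n, e, he⟩ i
    exact LimitWeak.isCoxeterNode_of_cartanA he i
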